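/- **Proposition (geometric structure of $\mathrm{US}_p^\alpha$).** Let $\mathbb G$ be a finite connected undirected graph whose nodes are points of $\mathbb R^n$ and whose edges are straight segments between nodes that meet only at common end-points; each edge $e$ has a length $w_e>0$. We identify $\mathbb G$ with the union of its nodes and edges, with the Euclidean topology. A piece of the edge $e=\langle u,v\rangle$ between $(1-s)u+sv$ and $(1-t)u+tv$ has length $|t-s|w_e$. Let $z_0$ be a node such that every $x\in\mathbb G$ is joined to $z_0$ by a unique shortest path, denoted $[z_0,x]$. Let $\mathcal M(\mathbb G)$ be the set of finite nonnegative Borel measures on $\mathbb G$, and let $\omega$ be a nonnegative Borel measure on $\mathbb G$. Let $b\ge 0$, $\lambda\ge 0$, let $w_1,w_2:\mathbb G\to\mathbb R$ satisfy $w_1(z_0),w_2(z_0)\ge 0$, let $1\le p\le\infty$ with conjugate exponent $p'$, and let $0\le\alpha<\frac{b\lambda}2+\min\{w_1(z_0),w_2(z_0)\}$. Let $\mathbb U_{p'}^\alpha$ be the set of continuous $f:\mathbb G\to\mathbb R$ with $$-w_2(z_0)-\tfrac{b\lambda}2+\alpha\le f(z_0)\le w_1(z_0)+\tfrac{b\lambda}2-\alpha$$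 for which there is $h\in L^{p'}(\mathbb G,\omega)$, $\|h\|_{L^{p'}(\mathbb G,\omega)}\le b$, such that for every $x\in\mathbb G$ the function $h$ is $\omega$-integrable on $[z_0,x]$ and $f(x)-f(z_0)=\int_{[z_0,x]}h\,d\omega$. For $\mu,\nu\in\mathcal M(\mathbb G)$ put $$\mathrm{US}_p^\alpha(\mu,\nu)=\sup_{f\in\mathbb U_{p'}^\alpha}\Big[\int_{\mathbb G} f\,d\mu-\int_{\mathbb G} f\,d\nu\Big]\in[-\infty,\infty].$$ Call $(b,\omega)$ *nondegenerate* if $b>0$ and every nondegenerate segment contained in an edge has positive $\omega$-measure after the atoms of $\omega$ are removed from it (for instance, $\omega$ is the length measure of $\mathbb G$). Then: 1. $\mathrm{US}_p^\alpha(\mu+\sigma,\nu+\sigma)=\mathrm{US}_p^\alpha(\mu,\nu)$ for all $\mu,\nu,\sigma\in\mathcal M(\mathbb G)$. 2. $\mathrm{US}_p^\alpha\ge 0$, $\mathrm{US}_p^\alpha(\mu,\mu)=0$, and $\mathrm{US}_p^\alpha(\mu,\nu)\le\mathrm{US}_p^\alpha(\mu,\sigma)+\mathrm{US}_p^\alpha(\sigma,\nu)$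 for all $\mu,\nu,\sigma\in\mathcal M(\mathbb G)$. If $(b,\omega)$ is nondegenerate and $\omega$ is $\sigma$-finite, then $\mathrm{US}_p^\alpha$ is a divergence: $\mathrm{US}_p^\alpha(\mu,\nu)=0$ if and only if $\mu=\nu$. 3. If $(b,\omega)$ is nondegenerate, $\omega$ is finite and $w_1(z_0)=w_2(z_0)$, then $\mathrm{US}_p^\alpha$ is a (finite-valued) metric and $(\mathcal M(\mathbb G),\mathrm{US}_p^\alpha)$ is a complete metric space. It is moreover a geodesic space: for all $\mu,\nu\in\mathcal M(\mathbb G)$, with $a=\mathrm{US}_p^\alpha(\mu,\nu)$, there is $\varphi:[0,a]\to\mathcal M(\mathbb G)$ with $\varphi(0)=\mu$, $\varphi(a)=\nu$ and $\mathrm{US}_p^\alpha(\varphi(t),\varphi(s))=|t-s|$ for all $t,s\in[0,a]$. -/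

import Mathlib

open MeasureTheory
open scoped ENNReal

/-- A finite, undirected, connected physical graph in `ℝⁿ`: the nodes are finitely many points of
`ℝⁿ`, an edge is the straight segment between its two end-points, and every edge carries a
positive length (which need not be its Euclidean length). Edges meet only at common end-points,
so that every point of the graph is a node or an interior point of exactly one edge. -/
structure PhysicalGraph (n : ℕ) where
  /-- the nodes -/
  nodes : Finset (EuclideanSpace ℝ (Fin n))
  /-- the edges, as an adjacency relation between nodes -/
  graph : SimpleGraph nodes
  connected : graph.Connected
  /-- the edge lengths `w_e` -/
  weight : Sym2 nodes → ℝ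
  weight_pos : ∀ e ∈ graph.edgeSet, 0 < weight e
  node_of_mem_segment : ∀ z u v : nodes, graph.Adj u v →
    (z : EuclideanSpace ℝ (Fin n)) ∈ segment ℝ (u : EuclideanSpace ℝ (Fin n)) v → z = u ∨ z = v
  edges_meet_at_nodes : ∀ u v u' v' : nodes, graph.Adj u v → graph.Adj u' v' →
    s(u, v) ≠ s(u', v') →
    segment ℝ (u : EuclideanSpace ℝ (Fin n)) v ∩ segment ℝ (u' : EuclideanSpace ℝ (Fin n)) v' ⊆
      (nodes : Set (EuclideanSpace ℝ (Fin n)))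

namespace PhysicalGraph

variable {n : ℕ} (G : PhysicalGraph n)

/-- The closed line segment in `ℝⁿ` that is occupied by the edge between `u` and `v`. -/
def edgeSegment (u v : G.nodes) : Set (EuclideanSpace ℝ (Fin n)) :=
  segment ℝ (u : EuclideanSpace ℝ (Fin n)) v

/-- The continuous graph as a subset of `ℝⁿ`: all nodes and all points of the edges. -/
def carrier : Set (EuclideanSpace ℝ (Fin n)) :=
  {x | x ∈ G.nodes ∨ ∃ u v : G.nodes, G.graph.Adj u v ∧ x ∈ G.edgeSegment u v}

/-- The points of the continuous graph, with the Euclidean topology and its Borel sets. -/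
abbrev Point : Type := ↥G.carrier

/-- A node, as a point of the graph. -/
def nodePoint (z : G.nodes) : G.Point := ⟨(z : EuclideanSpace ℝ (Fin n)), Or.inl z.2⟩

/-- The points of the graph on the line segment with end-points `x` and `y` (used for `x`, `y` on
a common edge). -/
def lineSegment (x y : G.Point) : Set G.Point :=
  {z | (z : EuclideanSpace ℝ (Fin n)) ∈
    segment ℝ (x : EuclideanSpace ℝ (Fin n)) (y : EuclideanSpace ℝ (Fin n))}

/-- Paths in the graph between two arbitrary points, broken down into finitely many pieces each of
which runs straight between two points of one edge. -/
inductive Path : G.Point → G.Point → Type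
  | nil (x : G.Point) : Path x x
  | cons {x y z : G.Point} (u v : G.nodes) (adj : G.graph.Adj u v)
      (hx : (x : EuclideanSpace ℝ (Fin n)) ∈ G.edgeSegment u v)
      (hy : (y : EuclideanSpace ℝ (Fin n)) ∈ G.edgeSegment u v) (p : Path y z) : Path x z

variable {G}

/-- The length of a path: the piece of the edge `e = ⟨u, v⟩` between `(1 - s) u + s v` and
`(1 - t) u + t v` has length `|t - s| w_e`, and lengths of pieces add up. -/
noncomputable def Path.length : {x y : G.Point} → G.Path x y → ℝ
  | _, _, .nil _ => 0
  | _, _, .cons (x := x) (y := y) u v _ _ _ p =>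
      dist x y / dist u v * G.weight s(u, v) + p.length

/-- The set of points that a path visits. -/
def Path.trace : {x y : G.Point} → G.Path x y → Set G.Point
  | _, _, .nil x => {x}
  | _, _, .cons (x := x) (y := y) _ _ _ _ _ p => G.lineSegment x y ∪ p.trace

/-- A path is shortest if no path with the same end-points is shorter. -/
def Path.IsShortest {x y : G.Point} (p : G.Path x y) : Prop :=
  ∀ q : G.Path x y, p.length ≤ q.length

variable (G)

/-- Every point `x` of the graph is joined to the root `z` by a unique shortest path (paths are
identified when they visit the same points; for shortest paths this is equality up to
reparametrization). -/
def UniqueShortestPaths (z : G.Point) : Prop :=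
  ∀ x : G.Point, ∃ p : G.Path z x, p.IsShortest ∧
    ∀ q : G.Path z x, q.IsShortest → q.trace = p.trace

/-- `[z, x]`: the set of points on the shortest path from `z` to `x`. -/
def shortestPath (z x : G.Point) : Set G.Point :=
  {y | ∃ p : G.Path z x, p.IsShortest ∧ y ∈ p.trace}

/-- `h ∈ L^q(ω)` is a graph derivative of `f` with root `z`:
`f(x) - f(z) = ∫_{[z,x]} h dω` for all `x`, the integrals being absolutely convergent. -/
def IsGraphDeriv (ω : Measure G.Point) (z : G.Point) (q : ℝ≥0∞) (f h : G.Point → ℝ) : Prop :=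
  MemLp h q ω ∧ ∀ x : G.Point, IntegrableOn h (G.shortestPath z x) ω ∧
    f x - f z = ∫ y in G.shortestPath z x, h y ∂ω

/-- The set `𝕌_q^α` of critics: the continuous `f` in the graph-based Sobolev space `W^{1,q}(ω)`
with `f(z) ∈ [-w₂(z) - bλ/2 + α, w₁(z) + bλ/2 - α]` and `‖f'‖_{L^q(ω)} ≤ b`. -/
def criticSet (ω : Measure G.Point) (z : G.Point) (b lam : ℝ) (w₁ w₂ : G.Point → ℝ) (α : ℝ)
    (q : ℝ≥0∞) : Set (G.Point → ℝ) :=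
  {f | Continuous f ∧
    f z ∈ Set.Icc (-w₂ z - b * lam / 2 + α) (w₁ z + b * lam / 2 - α) ∧
    ∃ h : G.Point → ℝ, G.IsGraphDeriv ω z q f h ∧ eLpNorm h q ω ≤ ENNReal.ofReal b}

/-- The unbalanced Sobolev transport `US_p^α(μ, ν)`, the supremum of `∫ f dμ - ∫ f dν` over the
critics `f ∈ 𝕌_{p'}^α` with `p'` conjugate to `p`, as an extended real number. -/
noncomputable def US (ω : Measure G.Point) (z : G.Point) (b lam : ℝ) (w₁ w₂ : G.Point → ℝ)
    (α : ℝ) (p : ℝ≥0∞) (μ ν : FiniteMeasure G.Point) : EReal :=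
  ⨆ f ∈ G.criticSet ω z b lam w₁ w₂ α p.conjExponent,
    ((∫ x, f x ∂(μ : Measure G.Point) - ∫ x, f x ∂(ν : Measure G.Point) : ℝ) : EReal)

/-- Every nondegenerate line segment contained in an edge has positive `ω`-measure, even after the
atoms of `ω` have been removed from it. The length measure of the graph is an example. -/
def ChargesSegments (ω : Measure G.Point) : Prop :=
  ∀ u v : G.nodes, G.graph.Adj u v → ∀ x y : G.Point,
    (x : EuclideanSpace ℝ (Fin n)) ∈ G.edgeSegment u v →
    (y : EuclideanSpace ℝ (Fin n)) ∈ G.edgeSegment u v → x ≠ y →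
    0 < ω {a | a ∈ G.lineSegment x y ∧ ω {a} = 0}

end PhysicalGraph

/-!
Since every point has a unique shortest path `[z, x]` to the root, the graph is a tree: on every
edge the distance from the root increases from one end-point to the other
(`isOutward_or_isOutward`), because otherwise an interior point of the edge would be reached by
shortest paths through both of its ends. Hence `[z, x]` enters an outward edge at its start and
fills it up to a coordinate `r x`, which defines a continuous retraction `r` of the graph onto the
edge (`exists_isEdgeRetraction`).

Separation: if `US(μ, ν) = 0`, then `μ` and `ν` give the same integral to every continuous `f`
with a graph derivative, small multiples of `±f` being critics (`integral_eq_of_US_eq_zero`). Graph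
derivatives that are supported on a set without atoms, inside a short piece of an edge, yield
continuous approximations of the indicator function of `{r > s}` (`exists_step_function`), so that
`μ` and `ν` have the same image under every retraction. Two retractions have product zero, or one
of them is `1` where the other does not vanish, and together they separate points. The algebra that
they generate is therefore spanned by `1` and their powers, and the Stone–Weierstrass theorem gives
`μ = ν` (`measure_ext_of_map_eq`).

Metric: for finite `ω` the critics are uniformly bounded by Hölder's inequality, and for
`w₁ z = w₂ z` they form a symmetric class. The dual metric of such a class is complete, since a
Cauchy sequence has bounded mass, hence a weak cluster point by compactness, and the distance is
lower semicontinuous for weak convergence; the segment from `μ` to `ν` is a geodesic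
(`exists_metricSpace`).
-/

namespace PhysicalGraph

variable {n : ℕ} {G : PhysicalGraph n}

/-! ### Edge coordinates -/

/-- The affine coordinate of a point `x` on the edge from `u` to `v`: it is `0` at `u` and `1` at
`v`. The value is only meaningful for points of that edge. -/
noncomputable def edgeParam (u v : G.nodes) (x : G.Point) : ℝ :=
  dist (u : EuclideanSpace ℝ (Fin n)) x / dist u v

lemma dist_pos_of_adj {u v : G.nodes} (h : G.graph.Adj u v) : 0 < dist u v :=
  dist_pos.2 h.ne

lemma weight_pos_of_adj {u v : G.nodes} (h : G.graph.Adj u v) : 0 < G.weight s(u, v) :=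
  G.weight_pos _ h

lemma continuous_edgeParam (u v : G.nodes) : Continuous (edgeParam (G := G) u v) :=
  (continuous_const.dist continuous_subtype_val).div_const _

lemma edgeSegment_swap (u v : G.nodes) : G.edgeSegment v u = G.edgeSegment u v :=
  segment_symm ..

lemma coe_eq_lineMap {u v : G.nodes} (h : G.graph.Adj u v) {x : G.Point}
    (hx : (x : EuclideanSpace ℝ (Fin n)) ∈ G.edgeSegment u v) :
    edgeParam u v x ∈ Set.Icc (0 : ℝ) 1 ∧
      (x : EuclideanSpace ℝ (Fin n)) =
        AffineMap.lineMap (u : EuclideanSpace ℝ (Fin n)) v (edgeParam u v x) := by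
  rw [edgeSegment, segment_eq_image_lineMap] at hx
  obtain ⟨t, ht, hx⟩ := hx
  have hd := dist_pos_of_adj h
  have : edgeParam u v x = t := by
    rw [edgeParam, ← hx, dist_left_lineMap, Real.norm_of_nonneg ht.1]
    exact mul_div_cancel_right₀ _ hd.ne'
  rw [this]
  exact ⟨ht, hx.symm⟩

lemma edgeParam_mem {u v : G.nodes} (h : G.graph.Adj u v) {x : G.Point}
    (hx : (x : EuclideanSpace ℝ (Fin n)) ∈ G.edgeSegment u v) :
    edgeParam u v x ∈ Set.Icc (0 : ℝ) 1 := (coe_eq_lineMap h hx).1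

lemma exists_edgeParam_eq {u v : G.nodes} (h : G.graph.Adj u v) {t : ℝ}
    (ht : t ∈ Set.Icc (0 : ℝ) 1) :
    ∃ x : G.Point, (x : EuclideanSpace ℝ (Fin n)) ∈ G.edgeSegment u v ∧ edgeParam u v x = t := by
  have hm : AffineMap.lineMap (u : EuclideanSpace ℝ (Fin n)) v t ∈ G.edgeSegment u v := by
    rw [edgeSegment, segment_eq_image_lineMap]
    exact ⟨t, ht, rfl⟩
  refine ⟨⟨_, Or.inr ⟨u, v, h, hm⟩⟩, hm, ?_⟩
  rw [edgeParam, dist_left_lineMap, Real.norm_of_nonneg ht.1]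
  exact mul_div_cancel_right₀ _ (dist_pos_of_adj h).ne'

lemma dist_eq_edgeParam {u v : G.nodes} (h : G.graph.Adj u v) {x y : G.Point}
    (hx : (x : EuclideanSpace ℝ (Fin n)) ∈ G.edgeSegment u v)
    (hy : (y : EuclideanSpace ℝ (Fin n)) ∈ G.edgeSegment u v) :
    dist x y = |edgeParam u v x - edgeParam u v y| * dist u v := by
  rw [Subtype.dist_eq, (coe_eq_lineMap h hx).2, (coe_eq_lineMap h hy).2, dist_lineMap_lineMap,
    Real.dist_eq]
  rfl

lemma dist_div_dist_eq {u v : G.nodes} (h : G.graph.Adj u v) {x y : G.Point}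
    (hx : (x : EuclideanSpace ℝ (Fin n)) ∈ G.edgeSegment u v)
    (hy : (y : EuclideanSpace ℝ (Fin n)) ∈ G.edgeSegment u v) :
    dist x y / dist u v = |edgeParam u v x - edgeParam u v y| := by
  rw [dist_eq_edgeParam h hx hy, mul_div_cancel_right₀ _ (dist_pos_of_adj h).ne']

lemma eq_of_edgeParam_eq {u v : G.nodes} (h : G.graph.Adj u v) {x y : G.Point}
    (hx : (x : EuclideanSpace ℝ (Fin n)) ∈ G.edgeSegment u v)
    (hy : (y : EuclideanSpace ℝ (Fin n)) ∈ G.edgeSegment u v)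
    (hxy : edgeParam u v x = edgeParam u v y) : x = y := by
  rw [← dist_eq_zero, dist_eq_edgeParam h hx hy, hxy]
  simp

lemma mem_lineSegment_iff {u v : G.nodes} (h : G.graph.Adj u v) {x y z : G.Point}
    (hx : (x : EuclideanSpace ℝ (Fin n)) ∈ G.edgeSegment u v)
    (hy : (y : EuclideanSpace ℝ (Fin n)) ∈ G.edgeSegment u v) :
    z ∈ G.lineSegment x y ↔ (z : EuclideanSpace ℝ (Fin n)) ∈ G.edgeSegment u v ∧
      edgeParam u v z ∈ Set.uIcc (edgeParam u v x) (edgeParam u v y) := by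
  have hs : z ∈ G.lineSegment x y ↔ (z : EuclideanSpace ℝ (Fin n)) ∈
      AffineMap.lineMap (u : EuclideanSpace ℝ (Fin n)) v ''
        Set.uIcc (edgeParam u v x) (edgeParam u v y) := by
    rw [lineSegment, Set.mem_ofPred_eq, (coe_eq_lineMap h hx).2, (coe_eq_lineMap h hy).2,
      ← image_segment, segment_eq_uIcc]
  rw [hs]
  constructor
  · rintro ⟨t, ht, hz⟩
    have ht' : t ∈ Set.Icc (0 : ℝ) 1 :=
      Set.uIcc_subset_Icc (edgeParam_mem h hx) (edgeParam_mem h hy) ht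
    have hp : edgeParam u v z = t := by
      rw [edgeParam, ← hz, dist_left_lineMap, Real.norm_of_nonneg ht'.1]
      exact mul_div_cancel_right₀ _ (dist_pos_of_adj h).ne'
    refine ⟨?_, hp ▸ ht⟩
    rw [edgeSegment, segment_eq_image_lineMap]
    exact ⟨t, ht', hz⟩
  · rintro ⟨hz, ht⟩
    exact ⟨_, ht, (coe_eq_lineMap h hz).2.symm⟩

lemma nodePoint_left_mem (u v : G.nodes) :
    (G.nodePoint u : EuclideanSpace ℝ (Fin n)) ∈ G.edgeSegment u v := left_mem_segment ..

lemma nodePoint_right_mem (u v : G.nodes) :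
    (G.nodePoint v : EuclideanSpace ℝ (Fin n)) ∈ G.edgeSegment u v := right_mem_segment ..

@[simp] lemma edgeParam_left (u v : G.nodes) : edgeParam u v (G.nodePoint u) = 0 := by
  simp [edgeParam, nodePoint]

lemma edgeParam_right {u v : G.nodes} (h : G.graph.Adj u v) :
    edgeParam u v (G.nodePoint v) = 1 := div_self (dist_pos_of_adj h).ne'

lemma edgeParam_swap {u v : G.nodes} (h : G.graph.Adj u v) {x : G.Point}
    (hx : (x : EuclideanSpace ℝ (Fin n)) ∈ G.edgeSegment u v) :
    edgeParam v u x = 1 - edgeParam u v x := by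
  have h1 := dist_div_dist_eq h (nodePoint_right_mem u v) hx
  rw [edgeParam_right h, abs_of_nonneg (sub_nonneg.2 (edgeParam_mem h hx).2)] at h1
  rw [← h1, dist_comm u v]
  rfl

lemma left_mem_lineSegment (x y : G.Point) : x ∈ G.lineSegment x y := left_mem_segment ..

lemma right_mem_lineSegment (x y : G.Point) : y ∈ G.lineSegment x y := right_mem_segment ..

lemma isCompact_segment (x y : EuclideanSpace ℝ (Fin n)) : IsCompact (segment ℝ x y) := by
  rw [segment_eq_image_lineMap]
  exact isCompact_Icc.image AffineMap.lineMap_continuous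

lemma isClosed_lineSegment (x y : G.Point) : IsClosed (G.lineSegment x y) :=
  (isCompact_segment _ _).isClosed.preimage continuous_subtype_val

lemma isClosed_edge (u v : G.nodes) :
    IsClosed {x : G.Point | (x : EuclideanSpace ℝ (Fin n)) ∈ G.edgeSegment u v} :=
  (isCompact_segment _ _).isClosed.preimage continuous_subtype_val

instance : CompactSpace G.Point := by
  rw [← isCompact_iff_compactSpace]
  have : G.carrier = (G.nodes : Set (EuclideanSpace ℝ (Fin n))) ∪
      ⋃ e ∈ {e : G.nodes × G.nodes | G.graph.Adj e.1 e.2}, G.edgeSegment e.1 e.2 := by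
    ext x
    simp [carrier]
  rw [this]
  exact (Finset.finite_toSet _).isCompact.union
    ((Set.toFinite _).isCompact_biUnion fun e _ => isCompact_segment _ _)

/-- A point on two edges is a node, unless the edges coincide up to orientation. -/
lemma edge_eq_or_node {u v u' v' : G.nodes} (h : G.graph.Adj u v) (h' : G.graph.Adj u' v')
    {x : G.Point} (hx : (x : EuclideanSpace ℝ (Fin n)) ∈ G.edgeSegment u v)
    (hx' : (x : EuclideanSpace ℝ (Fin n)) ∈ G.edgeSegment u' v') :
    (u = u' ∧ v = v') ∨ (u = v' ∧ v = u') ∨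
      ((x = G.nodePoint u ∨ x = G.nodePoint v) ∧ (x = G.nodePoint u' ∨ x = G.nodePoint v')) := by
  by_cases he : s(u, v) = s(u', v')
  · rcases Sym2.eq_iff.1 he with h1 | h1
    · exact Or.inl h1
    · exact Or.inr (Or.inl h1)
  · have hn : (x : EuclideanSpace ℝ (Fin n)) ∈ G.nodes :=
      G.edges_meet_at_nodes u v u' v' h h' he ⟨hx, hx'⟩
    have key : ∀ a : G.nodes, (⟨x, hn⟩ : G.nodes) = a → x = G.nodePoint a :=
      fun a e => e ▸ rfl
    exact Or.inr (Or.inr ⟨(G.node_of_mem_segment ⟨x, hn⟩ u v h hx).imp (key _) (key _),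
      (G.node_of_mem_segment ⟨x, hn⟩ u' v' h' hx').imp (key _) (key _)⟩)

/-! ### Paths -/

namespace Path

/-- Concatenation of paths. -/
def append : {x y z : G.Point} → G.Path x y → G.Path y z → G.Path x z
  | _, _, _, .nil _, q => q
  | _, _, _, .cons u v adj hx hy p, q => .cons u v adj hx hy (p.append q)

lemma length_append : ∀ {x y z : G.Point} (p : G.Path x y) (q : G.Path y z),
    (p.append q).length = p.length + q.length
  | _, _, _, .nil _, q => by simp [append, length]
  | _, _, _, .cons u v adj hx hy p, q => by simp [append, length, length_append p q, add_assoc]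

lemma start_mem_trace : ∀ {x y : G.Point} (p : G.Path x y), x ∈ p.trace
  | _, _, .nil _ => rfl
  | _, _, .cons _ _ _ _ _ _ => Or.inl (left_mem_lineSegment _ _)

lemma end_mem_trace : ∀ {x y : G.Point} (p : G.Path x y), y ∈ p.trace
  | _, _, .nil _ => rfl
  | _, _, .cons _ _ _ _ _ p => Or.inr p.end_mem_trace

lemma trace_append : ∀ {x y z : G.Point} (p : G.Path x y) (q : G.Path y z),
    (p.append q).trace = p.trace ∪ q.trace
  | _, _, _, .nil x, q => by
    simp [append, trace, Set.insert_eq_of_mem q.start_mem_trace]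
  | _, _, _, .cons u v adj hx hy p, q => by
    simp [append, trace, trace_append p q, Set.union_assoc]

lemma length_nonneg : ∀ {x y : G.Point} (p : G.Path x y), 0 ≤ p.length
  | _, _, .nil _ => le_rfl
  | _, _, .cons u v adj hx hy p =>
    add_nonneg (mul_nonneg (by positivity) (weight_pos_of_adj adj).le) p.length_nonneg

/-- The path that runs straight between two points of one edge. -/
def single {x y : G.Point} {u v : G.nodes} (adj : G.graph.Adj u v)
    (hx : (x : EuclideanSpace ℝ (Fin n)) ∈ G.edgeSegment u v)
    (hy : (y : EuclideanSpace ℝ (Fin n)) ∈ G.edgeSegment u v) : G.Path x y :=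
  .cons u v adj hx hy (.nil y)

lemma length_single {x y : G.Point} {u v : G.nodes} (adj : G.graph.Adj u v)
    (hx : (x : EuclideanSpace ℝ (Fin n)) ∈ G.edgeSegment u v)
    (hy : (y : EuclideanSpace ℝ (Fin n)) ∈ G.edgeSegment u v) :
    (single adj hx hy).length = |edgeParam u v x - edgeParam u v y| * G.weight s(u, v) := by
  simp [single, length, dist_div_dist_eq adj hx hy]

lemma trace_single {x y : G.Point} {u v : G.nodes} (adj : G.graph.Adj u v)
    (hx : (x : EuclideanSpace ℝ (Fin n)) ∈ G.edgeSegment u v)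
    (hy : (y : EuclideanSpace ℝ (Fin n)) ∈ G.edgeSegment u v) :
    (single adj hx hy).trace = G.lineSegment x y := by
  simp [single, trace, Set.insert_eq_of_mem (right_mem_lineSegment x y)]

lemma isClosed_trace : ∀ {x y : G.Point} (p : G.Path x y), IsClosed p.trace
  | _, _, .nil _ => isClosed_singleton
  | _, _, .cons _ _ _ _ _ p => (isClosed_lineSegment _ _).union p.isClosed_trace

/-- A path can be cut at any point that it visits. -/
lemma exists_split : ∀ {x z : G.Point} (p : G.Path x z) {y : G.Point}, y ∈ p.trace →
    ∃ (p₁ : G.Path x y) (p₂ : G.Path y z), p₁.length + p₂.length = p.length ∧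
      p₁.trace ∪ p₂.trace = p.trace
  | _, _, .nil x, y, hy => by
    obtain rfl : y = x := hy
    exact ⟨.nil y, .nil y, by simp [length], by simp⟩
  | x, z, .cons (y := a) u v adj hx ha p, y, hy => by
    rcases hy with hy | hy
    · obtain ⟨hye, hyt⟩ := (mem_lineSegment_iff adj hx ha).1 hy
      refine ⟨single adj hx hye, .cons u v adj hye ha p, ?_, ?_⟩
      · have h1 := dist_div_dist_eq adj hx ha
        have h2 := dist_div_dist_eq adj hye ha
        rw [length_single, length, length, h1, h2]
        rw [← add_assoc, ← add_mul]
        congr 2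
        rcases Set.mem_uIcc.1 hyt with ⟨h3, h4⟩ | ⟨h3, h4⟩
        · rw [abs_of_nonpos (by linarith), abs_of_nonpos (by linarith),
            abs_of_nonpos (by linarith)]
          ring
        · rw [abs_of_nonneg (by linarith), abs_of_nonneg (by linarith),
            abs_of_nonneg (by linarith)]
          ring
      · rw [trace_single, trace, trace, ← Set.union_assoc]
        congr 1
        ext b
        rw [Set.mem_union, mem_lineSegment_iff adj hx hye, mem_lineSegment_iff adj hye ha,
          mem_lineSegment_iff adj hx ha, ← and_or_left, ← Set.mem_union,
          Set.mem_union, Set.mem_uIcc, Set.mem_uIcc, Set.mem_uIcc]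
        refine and_congr_right fun _ => ?_
        rw [Set.mem_uIcc] at hyt
        grind
    · obtain ⟨p₁, p₂, hl, ht⟩ := p.exists_split hy
      refine ⟨.cons u v adj hx ha p₁, p₂, by simp [length, ← hl, add_assoc], ?_⟩
      simp [trace, ← ht, Set.union_assoc]

/-- A path between different points ends with a nondegenerate straight piece. -/
lemma exists_last_piece : ∀ {x z : G.Point} (p : G.Path x z), x ≠ z →
    ∃ (y : G.Point) (u v : G.nodes) (adj : G.graph.Adj u v)
      (hy : (y : EuclideanSpace ℝ (Fin n)) ∈ G.edgeSegment u v)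
      (hz : (z : EuclideanSpace ℝ (Fin n)) ∈ G.edgeSegment u v) (q : G.Path x y),
      y ≠ z ∧ q.length + (single adj hy hz).length ≤ p.length
  | _, _, .nil x, h => absurd rfl h
  | x, z, .cons (y := a) u v adj hx ha p, h => by
    by_cases haz : a = z
    · subst haz
      refine ⟨x, u, v, adj, hx, ha, .nil x, h, ?_⟩
      have := p.length_nonneg
      simp [length, single, this]
    · obtain ⟨y, u', v', adj', hy, hz, q, hne, hl⟩ := p.exists_last_piece haz
      refine ⟨y, u', v', adj', hy, hz, .cons u v adj hx ha q, hne, ?_⟩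
      rw [length, length, add_assoc]
      gcongr

lemma eq_of_length_eq_zero {x z : G.Point} (p : G.Path x z) (h : p.length = 0) : x = z := by
  by_contra hne
  obtain ⟨y, u, v, adj, hy, hz, q, hyz, hl⟩ := p.exists_last_piece hne
  have h1 : 0 < (single adj hy hz).length := by
    rw [length_single]
    refine mul_pos (abs_pos.2 (sub_ne_zero.2 fun h2 => hyz (eq_of_edgeParam_eq adj hy hz h2)))
      (weight_pos_of_adj adj)
  linarith [q.length_nonneg]

end Path

/-! ### Shortest paths from the root -/

/-- The length of a shortest path from `z` to `x`. -/
noncomputable def pathDist (z x : G.Point) : ℝ := ⨅ p : G.Path z x, p.length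

lemma pathDist_le {z x : G.Point} (p : G.Path z x) : pathDist z x ≤ p.length :=
  ciInf_le ⟨0, by rintro _ ⟨q, rfl⟩; exact q.length_nonneg⟩ p

lemma pathDist_nonneg (z x : G.Point) : 0 ≤ pathDist z x :=
  Real.iInf_nonneg fun p => p.length_nonneg

lemma Path.IsShortest.length_eq {z x : G.Point} {p : G.Path z x} (hp : p.IsShortest) :
    p.length = pathDist z x :=
  have : Nonempty (G.Path z x) := ⟨p⟩
  le_antisymm (le_ciInf hp) (pathDist_le p)

lemma Path.isShortest_of_length_le {z x : G.Point} {p : G.Path z x}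
    (hp : p.length ≤ pathDist z x) : p.IsShortest := fun q => hp.trans (pathDist_le q)

lemma pathDist_self (z : G.Point) : pathDist z z = 0 :=
  le_antisymm (pathDist_le (.nil z)) (pathDist_nonneg z z)

namespace UniqueShortestPaths

lemma shortestPath_eq {z : G.Point} (hz : G.UniqueShortestPaths z) {x : G.Point}
    {p : G.Path z x} (hp : p.IsShortest) : G.shortestPath z x = p.trace := by
  obtain ⟨q, -, hq⟩ := hz x
  ext y
  constructor
  · rintro ⟨r, hr, hy⟩
    rwa [hq p hp, ← hq r hr]
  · exact fun hy => ⟨p, hp, hy⟩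

lemma exists_shortest {z : G.Point} (hz : G.UniqueShortestPaths z) (x : G.Point) :
    ∃ p : G.Path z x, p.length = pathDist z x ∧ p.trace = G.shortestPath z x := by
  obtain ⟨p, hp, -⟩ := hz x
  exact ⟨p, hp.length_eq, (hz.shortestPath_eq hp).symm⟩

lemma isClosed_shortestPath {z : G.Point} (hz : G.UniqueShortestPaths z) (x : G.Point) :
    IsClosed (G.shortestPath z x) := by
  obtain ⟨p, -, hp⟩ := hz.exists_shortest x
  exact hp ▸ p.isClosed_trace

lemma pathDist_le_add {z : G.Point} (hz : G.UniqueShortestPaths z) {x y : G.Point}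
    (q : G.Path x y) : pathDist z y ≤ pathDist z x + q.length := by
  obtain ⟨p, hp, -⟩ := hz.exists_shortest x
  rw [← hp, ← Path.length_append]
  exact pathDist_le _

lemma root_mem {z : G.Point} (hz : G.UniqueShortestPaths z) (x : G.Point) :
    z ∈ G.shortestPath z x := by
  obtain ⟨p, -, hp⟩ := hz.exists_shortest x
  exact hp ▸ p.start_mem_trace

/-- A shortest path that visits `y` consists of a shortest path to `y` and a path from there. -/
lemma exists_split {z : G.Point} (hz : G.UniqueShortestPaths z) {x y : G.Point}
    (hy : y ∈ G.shortestPath z x) :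
    ∃ q : G.Path y x, pathDist z x = pathDist z y + q.length ∧
      G.shortestPath z x = G.shortestPath z y ∪ q.trace := by
  obtain ⟨p, hp, hy⟩ := hy
  obtain ⟨p₁, p₂, hl, ht⟩ := p.exists_split hy
  have h1 := hz.pathDist_le_add p₂
  have h2 := hp.length_eq
  have hs : p₁.IsShortest := Path.isShortest_of_length_le (by linarith)
  exact ⟨p₂, by rw [← hs.length_eq, hl, h2],
    by rw [hz.shortestPath_eq hp, hz.shortestPath_eq hs, ht]⟩

lemma pathDist_le_of_mem {z : G.Point} (hz : G.UniqueShortestPaths z) {x y : G.Point}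
    (hy : y ∈ G.shortestPath z x) : pathDist z y ≤ pathDist z x := by
  obtain ⟨q, hq, -⟩ := hz.exists_split hy
  linarith [q.length_nonneg]

lemma shortestPath_subset {z : G.Point} (hz : G.UniqueShortestPaths z) {x y : G.Point}
    (hy : y ∈ G.shortestPath z x) : G.shortestPath z y ⊆ G.shortestPath z x := by
  obtain ⟨q, -, hq⟩ := hz.exists_split hy
  exact hq ▸ Set.subset_union_left

/-- The points of `[z, x]` are linearly ordered by "lies on the shortest path to". -/
lemma mem_or_mem {z : G.Point} (hz : G.UniqueShortestPaths z) {x y y' : G.Point}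
    (hy : y ∈ G.shortestPath z x) (hy' : y' ∈ G.shortestPath z x) :
    y ∈ G.shortestPath z y' ∨ y' ∈ G.shortestPath z y := by
  obtain ⟨q, hl, hq⟩ := hz.exists_split hy
  rw [hq] at hy'
  rcases hy' with hy' | hy'
  · exact Or.inr hy'
  · left
    obtain ⟨q₁, q₂, hl', -⟩ := q.exists_split hy'
    obtain ⟨p, hp, -⟩ := hz.exists_shortest y
    have h1 := hz.pathDist_le_add q₂
    refine ⟨p.append q₁, Path.isShortest_of_length_le ?_, ?_⟩
    · rw [Path.length_append]
      linarith
    · rw [Path.trace_append]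
      exact Or.inl p.end_mem_trace

lemma eq_of_mem_of_mem {z : G.Point} (hz : G.UniqueShortestPaths z) {x y : G.Point}
    (hy : y ∈ G.shortestPath z x) (hx : x ∈ G.shortestPath z y) : x = y := by
  obtain ⟨q, hq, -⟩ := hz.exists_split hy
  have := hz.pathDist_le_of_mem hx
  exact (q.eq_of_length_eq_zero (le_antisymm (by linarith) q.length_nonneg)).symm

lemma shortestPath_self {z : G.Point} (hz : G.UniqueShortestPaths z) :
    G.shortestPath z z = {z} :=
  hz.shortestPath_eq (p := .nil z) fun q => q.length_nonneg

end UniqueShortestPaths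

/-! ### Orientation of the edges -/

/-- The distance from `z` to the point `x` of the edge between `u` and `v`, computed as the
smaller of the distances through `u` and through `v`. -/
noncomputable def edgeDist (z : G.Point) (u v : G.nodes) (x : G.Point) : ℝ :=
  min (pathDist z (G.nodePoint u) + edgeParam u v x * G.weight s(u, v))
    (pathDist z (G.nodePoint v) + (1 - edgeParam u v x) * G.weight s(u, v))

lemma edgeDist_swap (z : G.Point) {u v : G.nodes} (h : G.graph.Adj u v) {x : G.Point}
    (hx : (x : EuclideanSpace ℝ (Fin n)) ∈ G.edgeSegment u v) :
    edgeDist z v u x = edgeDist z u v x := by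
  rw [edgeDist, edgeDist, edgeParam_swap h hx, Sym2.eq_swap, min_comm, sub_sub_cancel]

lemma pathDist_le_edge {z : G.Point} (hz : G.UniqueShortestPaths z) {u v : G.nodes}
    (h : G.graph.Adj u v) {x y : G.Point}
    (hx : (x : EuclideanSpace ℝ (Fin n)) ∈ G.edgeSegment u v)
    (hy : (y : EuclideanSpace ℝ (Fin n)) ∈ G.edgeSegment u v) :
    pathDist z y ≤ pathDist z x + |edgeParam u v x - edgeParam u v y| * G.weight s(u, v) := by
  rw [← Path.length_single h hx hy]
  exact hz.pathDist_le_add _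

lemma edgeDist_left {z : G.Point} (hz : G.UniqueShortestPaths z) {u v : G.nodes}
    (h : G.graph.Adj u v) : edgeDist z u v (G.nodePoint u) = pathDist z (G.nodePoint u) := by
  have := pathDist_le_edge hz h (nodePoint_right_mem u v) (nodePoint_left_mem u v)
  rw [edgeParam_right h, edgeParam_left] at this
  rw [edgeDist, edgeParam_left, zero_mul, add_zero]
  exact min_eq_left (by simpa using this)

lemma edgeDist_right {z : G.Point} (hz : G.UniqueShortestPaths z) {u v : G.nodes}
    (h : G.graph.Adj u v) : edgeDist z u v (G.nodePoint v) = pathDist z (G.nodePoint v) := by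
  rw [← edgeDist_swap z h (nodePoint_right_mem u v), edgeDist_left hz h.symm]

lemma edgeDist_le_add (z : G.Point) {u v : G.nodes} (h : G.graph.Adj u v) (x y : G.Point) :
    edgeDist z u v y ≤
      edgeDist z u v x + |edgeParam u v x - edgeParam u v y| * G.weight s(u, v) := by
  have hw := (weight_pos_of_adj h).le
  have h1 := mul_le_mul_of_nonneg_right (le_abs_self (edgeParam u v x - edgeParam u v y)) hw
  have h2 := mul_le_mul_of_nonneg_right (neg_abs_le (edgeParam u v x - edgeParam u v y)) hw
  rw [edgeDist, edgeDist, ← min_add_add_right]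
  exact min_le_min (by linarith) (by linarith)

lemma edgeDist_congr {z : G.Point} (hz : G.UniqueShortestPaths z) {u v u' v' : G.nodes}
    (h : G.graph.Adj u v) (h' : G.graph.Adj u' v') {x : G.Point}
    (hx : (x : EuclideanSpace ℝ (Fin n)) ∈ G.edgeSegment u v)
    (hx' : (x : EuclideanSpace ℝ (Fin n)) ∈ G.edgeSegment u' v') :
    edgeDist z u v x = edgeDist z u' v' x := by
  rcases edge_eq_or_node h h' hx hx' with ⟨rfl, rfl⟩ | ⟨rfl, rfl⟩ | ⟨h1, h2⟩
  · rfl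
  · exact edgeDist_swap z h' hx'
  · have e1 : edgeDist z u v x = pathDist z x := by
      rcases h1 with rfl | rfl
      exacts [edgeDist_left hz h, edgeDist_right hz h]
    have e2 : edgeDist z u' v' x = pathDist z x := by
      rcases h2 with rfl | rfl
      exacts [edgeDist_left hz h', edgeDist_right hz h']
    rw [e1, e2]

/-- The functions `edgeDist` on the different edges fit together to a function that grows along a
path by at most its length. -/
lemma edgeDist_le_of_path {z : G.Point} (hz : G.UniqueShortestPaths z) :
    ∀ {a x : G.Point} (p : G.Path a x) (c : ℝ)
      (_ : ∀ u v : G.nodes, G.graph.Adj u v →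
        (a : EuclideanSpace ℝ (Fin n)) ∈ G.edgeSegment u v → edgeDist z u v a ≤ c)
      (u v : G.nodes), G.graph.Adj u v →
        (x : EuclideanSpace ℝ (Fin n)) ∈ G.edgeSegment u v → edgeDist z u v x ≤ c + p.length
  | _, _, .nil a, c, hc, u, v, h, hx => by simpa [Path.length] using hc u v h hx
  | _, _, .cons (x := a) (y := y) u₁ v₁ h₁ ha hy p, c, hc, u, v, h, hx => by
    rw [Path.length, ← add_assoc]
    refine edgeDist_le_of_path hz p _ (fun u₂ v₂ h₂ hy₂ => ?_) u v h hx
    rw [edgeDist_congr hz h₂ h₁ hy₂ hy, dist_div_dist_eq h₁ ha hy]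
    linarith [edgeDist_le_add z h₁ a y, hc u₁ v₁ h₁ ha]

lemma pathDist_eq_edgeDist {z₀ : G.nodes} (hz : G.UniqueShortestPaths (G.nodePoint z₀))
    {u v : G.nodes} (h : G.graph.Adj u v) {x : G.Point}
    (hx : (x : EuclideanSpace ℝ (Fin n)) ∈ G.edgeSegment u v) :
    pathDist (G.nodePoint z₀) x = edgeDist (G.nodePoint z₀) u v x := by
  have hτ := edgeParam_mem h hx
  apply le_antisymm
  · have h1 := pathDist_le_edge hz h (nodePoint_left_mem u v) hx
    have h2 := pathDist_le_edge hz h (nodePoint_right_mem u v) hx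
    rw [edgeParam_left, zero_sub, abs_neg, abs_of_nonneg hτ.1] at h1
    rw [edgeParam_right h, abs_of_nonneg (by linarith [hτ.2])] at h2
    exact le_min h1 h2
  · obtain ⟨p, hp, -⟩ := hz.exists_shortest x
    have := edgeDist_le_of_path hz p 0 (fun a b hab hab' => ?_) u v h hx
    · rwa [zero_add, hp] at this
    · rcases G.node_of_mem_segment z₀ a b hab hab' with rfl | rfl
      · rw [edgeDist_left hz hab, pathDist_self]
      · rw [edgeDist_right hz hab, pathDist_self]

/-- The edge from `u` to `v` is directed away from the root `z`: it is the end of a shortest path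
to `v`. -/
def IsOutward (z : G.Point) (u v : G.nodes) : Prop :=
  G.graph.Adj u v ∧
    pathDist z (G.nodePoint v) = pathDist z (G.nodePoint u) + G.weight s(u, v)

/-- Otherwise an interior point of the edge would be at the same distance from the root through
either end-point, and so be joined to the root by two shortest paths. -/
lemma isOutward_or_isOutward {z₀ : G.nodes} (hz : G.UniqueShortestPaths (G.nodePoint z₀))
    {u v : G.nodes} (h : G.graph.Adj u v) :
    IsOutward (G.nodePoint z₀) u v ∨ IsOutward (G.nodePoint z₀) v u := by
  by_contra hcon
  obtain ⟨hc1, hc2⟩ := not_or.1 hcon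
  have hw := weight_pos_of_adj h
  have h1 := pathDist_le_edge hz h (nodePoint_left_mem u v) (nodePoint_right_mem u v)
  have h2 := pathDist_le_edge hz h (nodePoint_right_mem u v) (nodePoint_left_mem u v)
  rw [edgeParam_left, edgeParam_right h] at h1 h2
  norm_num at h1 h2
  have h3 : pathDist (G.nodePoint z₀) (G.nodePoint v) <
      pathDist (G.nodePoint z₀) (G.nodePoint u) + G.weight s(u, v) :=
    lt_of_le_of_ne h1 fun e => hc1 ⟨h, e⟩
  have h4 : pathDist (G.nodePoint z₀) (G.nodePoint u) <
      pathDist (G.nodePoint z₀) (G.nodePoint v) + G.weight s(u, v) :=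
    lt_of_le_of_ne h2 fun e => hc2 ⟨h.symm, by rw [e, Sym2.eq_swap]⟩
  set w := G.weight s(u, v) with hwdef
  set a := pathDist (G.nodePoint z₀) (G.nodePoint u) with ha
  set b := pathDist (G.nodePoint z₀) (G.nodePoint v) with hb
  -- the coordinate of the point that is equally far from the root through `u` and through `v`
  obtain ⟨t, ht⟩ : ∃ t, t * w = (b + w - a) / 2 := ⟨(b + w - a) / 2 / w, div_mul_cancel₀ _ hw.ne'⟩
  have ht0 : 0 < t := pos_of_mul_pos_left (by linarith) hw.le
  have ht1 : t < 1 := lt_of_mul_lt_mul_right (by linarith : t * w < 1 * w) hw.le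
  obtain ⟨x, hx, hxt⟩ := exists_edgeParam_eq h ⟨ht0.le, ht1.le⟩
  have hx' : (x : EuclideanSpace ℝ (Fin n)) ∈ G.edgeSegment v u := by rwa [edgeSegment_swap]
  have hdx := pathDist_eq_edgeDist hz h hx
  rw [edgeDist, hxt, ← ha, ← hb, ← hwdef, min_eq_left (by linarith)] at hdx
  obtain ⟨p, hp, -⟩ := hz.exists_shortest (G.nodePoint u)
  obtain ⟨q, hq, -⟩ := hz.exists_shortest (G.nodePoint v)
  have hps : (p.append (Path.single h (nodePoint_left_mem u v) hx)).IsShortest := by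
    refine Path.isShortest_of_length_le ?_
    rw [Path.length_append, Path.length_single, hp, edgeParam_left, hxt, zero_sub, abs_neg,
      abs_of_pos ht0, hdx]
  have hqs : (q.append (Path.single h (nodePoint_right_mem u v) hx)).IsShortest := by
    refine Path.isShortest_of_length_le ?_
    rw [Path.length_append, Path.length_single, hq, edgeParam_right h, hxt,
      abs_of_pos (by linarith), hdx]
    linarith
  -- a point `y` shortly after `x` lies on the path through `v`, but is too far to lie on `[z, u]`
  obtain ⟨s, hs0, hs1, hs2⟩ : ∃ s, t < s ∧ s < 1 ∧ s < 2 * t := by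
    obtain ⟨s, hs, hs'⟩ := exists_between (lt_min ht1 (by linarith : t < 2 * t))
    exact ⟨s, hs, hs'.trans_le (min_le_left _ _), hs'.trans_le (min_le_right _ _)⟩
  obtain ⟨y, hy, hys⟩ := exists_edgeParam_eq h (t := s) ⟨by linarith, hs1.le⟩
  have hyq : y ∈ (q.append (Path.single h (nodePoint_right_mem u v) hx)).trace := by
    rw [Path.trace_append, Path.trace_single]
    right
    rw [mem_lineSegment_iff h (nodePoint_right_mem u v) hx, edgeParam_right h, hxt, hys]
    exact ⟨hy, Set.mem_uIcc.2 (Or.inr ⟨hs0.le, hs1.le⟩)⟩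
  rw [← hz.shortestPath_eq hqs, hz.shortestPath_eq hps, Path.trace_append,
    Path.trace_single] at hyq
  rcases hyq with hyp | hyx
  · have h5 := hz.pathDist_le_of_mem
      ((hz.shortestPath_eq (Path.isShortest_of_length_le hp.le)).symm ▸ hyp)
    have h6 := mul_lt_mul_of_pos_right hs2 hw
    have h7 : 0 < s * w := mul_pos (by linarith) hw
    rw [pathDist_eq_edgeDist hz h hy, edgeDist, hys, ← ha, ← hb, ← hwdef] at h5
    rcases min_le_iff.1 h5 with h8 | h8 <;> linarith
  · rw [mem_lineSegment_iff h (nodePoint_left_mem u v) hx, edgeParam_left, hxt, hys,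
      Set.uIcc_of_le ht0.le] at hyx
    linarith [hyx.2.2]

namespace IsOutward

variable {z₀ u v : G.nodes}

lemma pathDist_eq (hz : G.UniqueShortestPaths (G.nodePoint z₀))
    (he : IsOutward (G.nodePoint z₀) u v) {x : G.Point}
    (hx : (x : EuclideanSpace ℝ (Fin n)) ∈ G.edgeSegment u v) :
    pathDist (G.nodePoint z₀) x =
      pathDist (G.nodePoint z₀) (G.nodePoint u) + edgeParam u v x * G.weight s(u, v) := by
  have hτ := edgeParam_mem he.1 hx
  have hw := weight_pos_of_adj he.1
  rw [pathDist_eq_edgeDist hz he.1 hx, edgeDist, he.2]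
  refine min_eq_left ?_
  nlinarith [mul_nonneg (sub_nonneg.2 hτ.2) hw.le]

lemma shortestPath_eq (hz : G.UniqueShortestPaths (G.nodePoint z₀))
    (he : IsOutward (G.nodePoint z₀) u v) {x : G.Point}
    (hx : (x : EuclideanSpace ℝ (Fin n)) ∈ G.edgeSegment u v) :
    G.shortestPath (G.nodePoint z₀) x =
      G.shortestPath (G.nodePoint z₀) (G.nodePoint u) ∪ G.lineSegment (G.nodePoint u) x := by
  obtain ⟨p, hp, hpt⟩ := hz.exists_shortest (G.nodePoint u)
  rw [hz.shortestPath_eq (p := p.append (Path.single he.1 (nodePoint_left_mem u v) hx)),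
    Path.trace_append, Path.trace_single, hpt]
  refine Path.isShortest_of_length_le ?_
  rw [Path.length_append, Path.length_single, hp, edgeParam_left, zero_sub, abs_neg,
    abs_of_nonneg (edgeParam_mem he.1 hx).1, he.pathDist_eq hz hx]

lemma mem_lineSegment_left (he : IsOutward (G.nodePoint z₀) u v) {x y : G.Point}
    (hx : (x : EuclideanSpace ℝ (Fin n)) ∈ G.edgeSegment u v) :
    y ∈ G.lineSegment (G.nodePoint u) x ↔ (y : EuclideanSpace ℝ (Fin n)) ∈ G.edgeSegment u v ∧
      edgeParam u v y ≤ edgeParam u v x := by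
  rw [mem_lineSegment_iff he.1 (nodePoint_left_mem u v) hx, edgeParam_left,
    Set.uIcc_of_le (edgeParam_mem he.1 hx).1]
  exact and_congr_right fun hy => ⟨fun h => h.2, fun h => ⟨(edgeParam_mem he.1 hy).1, h⟩⟩

end IsOutward

/-- Every point but the root lies past the start of an outward edge. -/
lemma exists_isOutward {z₀ : G.nodes} (hz : G.UniqueShortestPaths (G.nodePoint z₀))
    {x : G.Point} (hx : x ≠ G.nodePoint z₀) :
    ∃ u v, IsOutward (G.nodePoint z₀) u v ∧
      (x : EuclideanSpace ℝ (Fin n)) ∈ G.edgeSegment u v ∧ 0 < edgeParam u v x := by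
  obtain ⟨p, hp, -⟩ := hz.exists_shortest x
  obtain ⟨y, u, v, h, hy, hx, q, hne, hl⟩ := p.exists_last_piece (Ne.symm hx)
  have h1 := pathDist_le q
  wlog he : IsOutward (G.nodePoint z₀) u v generalizing u v
  · refine this v u h.symm (edgeSegment_swap u v ▸ hy) (edgeSegment_swap u v ▸ hx) ?_
      ((isOutward_or_isOutward hz h).resolve_left he)
    rwa [Path.length_single, edgeParam_swap h hx, edgeParam_swap h hy, sub_sub_sub_cancel_left,
      Sym2.eq_swap, abs_sub_comm, ← Path.length_single h hy hx]
  · refine ⟨u, v, he, hx, ?_⟩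
    have hw := weight_pos_of_adj h
    rw [Path.length_single, hp, he.pathDist_eq hz hx] at hl
    rw [he.pathDist_eq hz hy] at h1
    by_contra hx0
    have hx0' : edgeParam u v x = 0 := le_antisymm (not_lt.1 hx0) (edgeParam_mem h hx).1
    have hy0 := (edgeParam_mem h hy).1
    rw [hx0', sub_zero, abs_of_nonneg hy0] at hl
    have : edgeParam u v y * G.weight s(u, v) ≤ 0 := by linarith
    exact hne (eq_of_edgeParam_eq h hy hx (by nlinarith))

/-! ### Retractions onto the edges -/

namespace IsOutward

variable {z₀ u v u' v' : G.nodes}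

/-- Two outward edges that share an interior point of the first are equal. -/
lemma eq_of_mem (he : IsOutward (G.nodePoint z₀) u v) (he' : IsOutward (G.nodePoint z₀) u' v')
    {y : G.Point} (hy : (y : EuclideanSpace ℝ (Fin n)) ∈ G.edgeSegment u v)
    (hy' : (y : EuclideanSpace ℝ (Fin n)) ∈ G.edgeSegment u' v')
    (hτ : edgeParam u v y ∈ Set.Ioo (0 : ℝ) 1) : (u, v) = (u', v') := by
  rcases edge_eq_or_node he.1 he'.1 hy hy' with ⟨rfl, rfl⟩ | ⟨rfl, rfl⟩ | ⟨rfl | rfl, -⟩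
  · rfl
  · have h1 := he.2
    have h2 := he'.2
    rw [Sym2.eq_swap] at h2
    linarith [weight_pos_of_adj he.1]
  · rw [edgeParam_left] at hτ
    exact absurd hτ.1 (lt_irrefl _)
  · rw [edgeParam_right he.1] at hτ
    exact absurd hτ.2 (lt_irrefl _)

lemma mem_shortestPath_iff_of_ne (hz : G.UniqueShortestPaths (G.nodePoint z₀))
    (he : IsOutward (G.nodePoint z₀) u v) (he' : IsOutward (G.nodePoint z₀) u' v')
    (hne : (u, v) ≠ (u', v')) {x y : G.Point}
    (hx : (x : EuclideanSpace ℝ (Fin n)) ∈ G.edgeSegment u' v')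
    (hy : (y : EuclideanSpace ℝ (Fin n)) ∈ G.edgeSegment u v)
    (hτ : edgeParam u v y ∈ Set.Ioo (0 : ℝ) 1) :
    y ∈ G.shortestPath (G.nodePoint z₀) x ↔
      y ∈ G.shortestPath (G.nodePoint z₀) (G.nodePoint u') := by
  rw [he'.shortestPath_eq hz hx]
  refine ⟨fun h => h.resolve_right fun h' => hne ?_, Or.inl⟩
  exact he.eq_of_mem he' hy ((he'.mem_lineSegment_left hx).1 h').1 hτ

lemma mem_shortestPath_iff (hz : G.UniqueShortestPaths (G.nodePoint z₀))
    (he : IsOutward (G.nodePoint z₀) u v) {x y : G.Point}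
    (hx : (x : EuclideanSpace ℝ (Fin n)) ∈ G.edgeSegment u v)
    (hy : (y : EuclideanSpace ℝ (Fin n)) ∈ G.edgeSegment u v)
    (hτ : 0 < edgeParam u v y) :
    y ∈ G.shortestPath (G.nodePoint z₀) x ↔ edgeParam u v y ≤ edgeParam u v x := by
  rw [he.shortestPath_eq hz hx, Set.mem_union, he.mem_lineSegment_left hx]
  refine ⟨fun h => (h.resolve_left fun h' => ?_).2, fun h => Or.inr ⟨hy, h⟩⟩
  have h1 := hz.pathDist_le_of_mem h'
  rw [he.pathDist_eq hz hy] at h1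
  linarith [mul_pos hτ (weight_pos_of_adj he.1)]

/-- A shortest path to a node contains the whole interior of an edge or none of it. -/
lemma interior_subset_or_disjoint (hz : G.UniqueShortestPaths (G.nodePoint z₀))
    (he : IsOutward (G.nodePoint z₀) u v) (c : G.nodes) :
    (∀ y : G.Point, (y : EuclideanSpace ℝ (Fin n)) ∈ G.edgeSegment u v →
      edgeParam u v y ∈ Set.Ioo (0 : ℝ) 1 →
      y ∈ G.shortestPath (G.nodePoint z₀) (G.nodePoint c)) ∨
    (∀ y : G.Point, (y : EuclideanSpace ℝ (Fin n)) ∈ G.edgeSegment u v →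
      edgeParam u v y ∈ Set.Ioo (0 : ℝ) 1 →
      y ∉ G.shortestPath (G.nodePoint z₀) (G.nodePoint c)) := by
  -- induction along the tree, by the distance from the root
  let R : G.nodes → G.nodes → Prop := fun a a' =>
    pathDist (G.nodePoint z₀) (G.nodePoint a) < pathDist (G.nodePoint z₀) (G.nodePoint a')
  have : IsTrans G.nodes R := ⟨fun _ _ _ => lt_trans⟩
  have : Std.Irrefl R := ⟨fun _ => lt_irrefl _⟩
  induction c using (Finite.wellFounded_of_trans_of_irrefl R).induction with
  | _ c ih =>
  by_cases hc : G.nodePoint c = G.nodePoint z₀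
  · right
    intro y hy hτ hyc
    rw [hc, hz.shortestPath_self] at hyc
    obtain rfl : y = G.nodePoint z₀ := hyc
    rcases G.node_of_mem_segment z₀ u v he.1 hy with rfl | rfl
    · rw [edgeParam_left] at hτ
      exact lt_irrefl _ hτ.1
    · rw [edgeParam_right he.1] at hτ
      exact lt_irrefl _ hτ.2
  · obtain ⟨a, b, hab, hcab, hpos⟩ := exists_isOutward hz hc
    have hcb : c = b := by
      rcases G.node_of_mem_segment c a b hab.1 hcab with rfl | rfl
      · rw [edgeParam_left] at hpos
        exact absurd hpos (lt_irrefl _)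
      · rfl
    subst hcb
    by_cases heq : (u, v) = (a, c)
    · left
      obtain ⟨rfl, rfl⟩ := Prod.mk.inj heq
      intro y hy hτ
      rw [he.mem_shortestPath_iff hz hcab hy hτ.1, edgeParam_right he.1]
      exact hτ.2.le
    · have hlt : R a c := by
        change pathDist _ _ < pathDist _ _
        rw [hab.2]
        linarith [weight_pos_of_adj hab.1]
      refine (ih a hlt).imp (fun h y hy hτ => ?_) fun h y hy hτ => ?_
      · rw [mem_shortestPath_iff_of_ne hz he hab heq hcab hy hτ]
        exact h y hy hτ
      · rw [mem_shortestPath_iff_of_ne hz he hab heq hcab hy hτ]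
        exact h y hy hτ

end IsOutward

/-- The retraction of the graph onto the outward edge from `u` to `v`, in the affine coordinate of
that edge: `r x` is the coordinate up to which the path `[z, x]` fills the edge. Only interior
points of the edge are tested, since its end-points may also be reached through other edges. -/
def IsEdgeRetraction (z : G.Point) (u v : G.nodes) (r : G.Point → ℝ) : Prop :=
  ∀ x, r x ∈ Set.Icc (0 : ℝ) 1 ∧ ∀ y : G.Point,
    (y : EuclideanSpace ℝ (Fin n)) ∈ G.edgeSegment u v → edgeParam u v y ∈ Set.Ioo (0 : ℝ) 1 →
      (y ∈ G.shortestPath z x ↔ edgeParam u v y ≤ r x)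

/-- The interior points of an edge determine a coordinate in the unit interval. -/
lemma eq_of_interior_le_iff {u v : G.nodes} (h : G.graph.Adj u v) {s t : ℝ}
    (hs : s ∈ Set.Icc (0 : ℝ) 1) (ht : t ∈ Set.Icc (0 : ℝ) 1)
    (hst : ∀ y : G.Point, (y : EuclideanSpace ℝ (Fin n)) ∈ G.edgeSegment u v →
      edgeParam u v y ∈ Set.Ioo (0 : ℝ) 1 → (edgeParam u v y ≤ s ↔ edgeParam u v y ≤ t)) :
    s = t := by
  by_contra hne
  wlog hlt : s < t generalizing s t
  · exact this ht hs (fun y hy hτ => (hst y hy hτ).symm) (Ne.symm hne)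
      (lt_of_le_of_ne (not_lt.1 hlt) (Ne.symm hne))
  obtain ⟨a, ha, ha'⟩ := exists_between hlt
  have ha0 : 0 < a := hs.1.trans_lt ha
  have ha1 : a < 1 := ha'.trans_le ht.2
  obtain ⟨y, hy, rfl⟩ := exists_edgeParam_eq h (t := a) ⟨ha0.le, ha1.le⟩
  exact absurd ((hst y hy ⟨ha0, ha1⟩).2 ha'.le) (not_le.2 ha)

namespace IsEdgeRetraction

variable {z₀ u v u' v' : G.nodes} {r r' : G.Point → ℝ}

lemma eq_edgeParam (hz : G.UniqueShortestPaths (G.nodePoint z₀))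
    (he : IsOutward (G.nodePoint z₀) u v) (hr : IsEdgeRetraction (G.nodePoint z₀) u v r)
    {x : G.Point} (hx : (x : EuclideanSpace ℝ (Fin n)) ∈ G.edgeSegment u v) :
    r x = edgeParam u v x :=
  eq_of_interior_le_iff he.1 (hr x).1 (edgeParam_mem he.1 hx) fun y hy hτ => by
    rw [← (hr x).2 y hy hτ, he.mem_shortestPath_iff hz hx hy hτ.1]

lemma eq_of_ne (hz : G.UniqueShortestPaths (G.nodePoint z₀))
    (he : IsOutward (G.nodePoint z₀) u v) (he' : IsOutward (G.nodePoint z₀) u' v')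
    (hne : (u, v) ≠ (u', v')) (hr : IsEdgeRetraction (G.nodePoint z₀) u v r)
    {x : G.Point} (hx : (x : EuclideanSpace ℝ (Fin n)) ∈ G.edgeSegment u' v') :
    r x = r (G.nodePoint u') :=
  eq_of_interior_le_iff he.1 (hr x).1 (hr _).1 fun y hy hτ => by
    rw [← (hr x).2 y hy hτ, ← (hr _).2 y hy hτ, he.mem_shortestPath_iff_of_ne hz he' hne hx hy hτ]

lemma eq_one (h : G.graph.Adj u v) (hr : IsEdgeRetraction (G.nodePoint z₀) u v r) {x : G.Point}
    (hx : ∀ y : G.Point, (y : EuclideanSpace ℝ (Fin n)) ∈ G.edgeSegment u v →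
      edgeParam u v y ∈ Set.Ioo (0 : ℝ) 1 → y ∈ G.shortestPath (G.nodePoint z₀) x) :
    r x = 1 :=
  eq_of_interior_le_iff h (hr x).1 ⟨zero_le_one, le_rfl⟩ fun y hy hτ =>
    iff_of_true (((hr x).2 y hy hτ).1 (hx y hy hτ)) hτ.2.le

lemma exists_interior_mem (h : G.graph.Adj u v) (hr : IsEdgeRetraction (G.nodePoint z₀) u v r)
    {x : G.Point} (hx : r x ≠ 0) :
    ∃ y : G.Point, (y : EuclideanSpace ℝ (Fin n)) ∈ G.edgeSegment u v ∧
      edgeParam u v y ∈ Set.Ioo (0 : ℝ) 1 ∧ y ∈ G.shortestPath (G.nodePoint z₀) x := by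
  have hx0 : 0 < r x := lt_of_le_of_ne (hr x).1.1 (Ne.symm hx)
  obtain ⟨a, ha, ha'⟩ := exists_between hx0
  have ha1 : a < 1 := ha'.trans_le (hr x).1.2
  obtain ⟨y, hy, rfl⟩ := exists_edgeParam_eq h (t := a) ⟨ha.le, ha1.le⟩
  exact ⟨y, hy, ⟨ha, ha1⟩, ((hr x).2 y hy ⟨ha, ha1⟩).2 ha'.le⟩

lemma eq_zero_root (hz : G.UniqueShortestPaths (G.nodePoint z₀)) (h : G.graph.Adj u v)
    (hr : IsEdgeRetraction (G.nodePoint z₀) u v r) : r (G.nodePoint z₀) = 0 := by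
  by_contra hne
  obtain ⟨y, hy, hτ, hyz⟩ := hr.exists_interior_mem h hne
  rw [hz.shortestPath_self] at hyz
  obtain rfl : y = G.nodePoint z₀ := hyz
  rcases G.node_of_mem_segment z₀ u v h hy with rfl | rfl
  · rw [edgeParam_left] at hτ
    exact lt_irrefl _ hτ.1
  · rw [edgeParam_right h] at hτ
    exact lt_irrefl _ hτ.2

/-- If `[z, u']` runs through the edge from `u` to `v`, then so does every shortest path that
enters the edge from `u'` to `v'`. -/
lemma mul_eq_right (hz : G.UniqueShortestPaths (G.nodePoint z₀)) (h : G.graph.Adj u v)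
    (he' : IsOutward (G.nodePoint z₀) u' v')
    (hr : IsEdgeRetraction (G.nodePoint z₀) u v r)
    (hr' : IsEdgeRetraction (G.nodePoint z₀) u' v' r')
    (hall : ∀ y : G.Point, (y : EuclideanSpace ℝ (Fin n)) ∈ G.edgeSegment u v →
      edgeParam u v y ∈ Set.Ioo (0 : ℝ) 1 →
      y ∈ G.shortestPath (G.nodePoint z₀) (G.nodePoint u')) (x : G.Point) :
    r x * r' x = r' x := by
  by_cases h0 : r' x = 0
  · rw [h0, mul_zero]
  · obtain ⟨y', hy', -, hyx⟩ := hr'.exists_interior_mem he'.1 h0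
    have hsub := hz.shortestPath_subset hyx
    rw [he'.shortestPath_eq hz hy'] at hsub
    rw [hr.eq_one h fun y hy hτ => hsub (Or.inl (hall y hy hτ)), one_mul]

/-- The edges of the tree are partially ordered: retractions onto different edges have product
zero, or one of them is `1` wherever the other does not vanish. -/
lemma mul_eq (hz : G.UniqueShortestPaths (G.nodePoint z₀))
    (he : IsOutward (G.nodePoint z₀) u v) (he' : IsOutward (G.nodePoint z₀) u' v')
    (hne : (u, v) ≠ (u', v'))
    (hr : IsEdgeRetraction (G.nodePoint z₀) u v r)
    (hr' : IsEdgeRetraction (G.nodePoint z₀) u' v' r') :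
    (∀ x, r x * r' x = 0) ∨ (∀ x, r x * r' x = r' x) ∨ ∀ x, r x * r' x = r x := by
  rcases he.interior_subset_or_disjoint hz u' with h1 | h1
  · exact Or.inr (Or.inl (hr.mul_eq_right hz he.1 he' hr' h1))
  rcases he'.interior_subset_or_disjoint hz u with h2 | h2
  · refine Or.inr (Or.inr fun x => ?_)
    rw [mul_comm]
    exact hr'.mul_eq_right hz he'.1 he hr h2 x
  left
  intro x
  by_contra h0
  obtain ⟨y, hy, hτ, hyx⟩ := hr.exists_interior_mem he.1 (left_ne_zero_of_mul h0)
  obtain ⟨y', hy', hτ', hyx'⟩ := hr'.exists_interior_mem he'.1 (right_ne_zero_of_mul h0)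
  rcases hz.mem_or_mem hyx hyx' with h3 | h3
  · exact h1 y hy hτ ((he.mem_shortestPath_iff_of_ne hz he' hne hy' hy hτ).1 h3)
  · exact h2 y' hy' hτ' ((he'.mem_shortestPath_iff_of_ne hz he hne.symm hy hy' hτ').1 h3)

lemma continuous (hz : G.UniqueShortestPaths (G.nodePoint z₀))
    (he : IsOutward (G.nodePoint z₀) u v) (hr : IsEdgeRetraction (G.nodePoint z₀) u v r) :
    Continuous r := by
  -- the graph is covered by its finitely many outward edges and the root
  let S : Option {e : G.nodes × G.nodes // IsOutward (G.nodePoint z₀) e.1 e.2} → Set G.Point :=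
    fun o => o.elim {G.nodePoint z₀}
      fun e => {x | (x : EuclideanSpace ℝ (Fin n)) ∈ G.edgeSegment e.1.1 e.1.2}
  refine (locallyFinite_of_finite S).continuous ?_ ?_ ?_
  · refine Set.eq_univ_of_forall fun x => Set.mem_iUnion.2 ?_
    by_cases hx : x = G.nodePoint z₀
    · exact ⟨none, hx⟩
    · obtain ⟨a, b, hab, hxab, -⟩ := exists_isOutward hz hx
      exact ⟨some ⟨(a, b), hab⟩, hxab⟩
  · rintro (_ | ⟨⟨a, b⟩, hab⟩)
    · exact isClosed_singleton
    · exact isClosed_edge a b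
  · rintro (_ | ⟨⟨a, b⟩, hab⟩)
    · exact continuousOn_singleton _ _
    · by_cases heq : (u, v) = (a, b)
      · obtain ⟨rfl, rfl⟩ := Prod.mk.inj heq
        exact (continuous_edgeParam u v).continuousOn.congr fun x hx => hr.eq_edgeParam hz he hx
      · exact continuousOn_const.congr fun x hx => hr.eq_of_ne hz he hab heq hx

end IsEdgeRetraction

lemma exists_isEdgeRetraction {z₀ u v : G.nodes} (hz : G.UniqueShortestPaths (G.nodePoint z₀))
    (he : IsOutward (G.nodePoint z₀) u v) :
    ∃ r : C(G.Point, ℝ), IsEdgeRetraction (G.nodePoint z₀) u v r := by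
  have hnode : ∀ c : G.nodes, ∃ t ∈ Set.Icc (0 : ℝ) 1, ∀ y : G.Point,
      (y : EuclideanSpace ℝ (Fin n)) ∈ G.edgeSegment u v → edgeParam u v y ∈ Set.Ioo (0 : ℝ) 1 →
        (y ∈ G.shortestPath (G.nodePoint z₀) (G.nodePoint c) ↔ edgeParam u v y ≤ t) := by
    intro c
    rcases he.interior_subset_or_disjoint hz c with h | h
    · exact ⟨1, ⟨zero_le_one, le_rfl⟩, fun y hy hτ => iff_of_true (h y hy hτ) hτ.2.le⟩
    · exact ⟨0, ⟨le_rfl, zero_le_one⟩, fun y hy hτ => iff_of_false (h y hy hτ) (not_le.2 hτ.1)⟩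
  have hex : ∀ x : G.Point, ∃ t : ℝ, t ∈ Set.Icc (0 : ℝ) 1 ∧ ∀ y : G.Point,
      (y : EuclideanSpace ℝ (Fin n)) ∈ G.edgeSegment u v → edgeParam u v y ∈ Set.Ioo (0 : ℝ) 1 →
        (y ∈ G.shortestPath (G.nodePoint z₀) x ↔ edgeParam u v y ≤ t) := by
    intro x
    by_cases hx : x = G.nodePoint z₀
    · rw [hx]
      exact hnode z₀
    · obtain ⟨a, b, hab, hxab, -⟩ := exists_isOutward hz hx
      by_cases heq : (u, v) = (a, b)
      · obtain ⟨rfl, rfl⟩ := Prod.mk.inj heq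
        exact ⟨_, edgeParam_mem he.1 hxab, fun y hy hτ => he.mem_shortestPath_iff hz hxab hy hτ.1⟩
      · obtain ⟨t, ht, h⟩ := hnode a
        refine ⟨t, ht, fun y hy hτ => ?_⟩
        rw [he.mem_shortestPath_iff_of_ne hz hab heq hxab hy hτ, h y hy hτ]
  choose r hr using hex
  exact ⟨⟨r, IsEdgeRetraction.continuous hz he hr⟩, hr⟩

/-- If all retractions agree at `x` and `x'`, then `[z, x']` contains every point shortly before
`x`, and hence `x`. -/
lemma mem_shortestPath_of_retractions_eq {z₀ : G.nodes}
    (hz : G.UniqueShortestPaths (G.nodePoint z₀)) {x x' : G.Point}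
    (h : ∀ u v, IsOutward (G.nodePoint z₀) u v → ∀ r : G.Point → ℝ,
      IsEdgeRetraction (G.nodePoint z₀) u v r → r x = r x') :
    x ∈ G.shortestPath (G.nodePoint z₀) x' := by
  by_cases hx : x = G.nodePoint z₀
  · rw [hx]
    exact hz.root_mem x'
  obtain ⟨u, v, he, hxe, hpos⟩ := exists_isOutward hz hx
  obtain ⟨r, hr⟩ := exists_isEdgeRetraction hz he
  have hrx := hr.eq_edgeParam hz he hxe
  rw [← (hz.isClosed_shortestPath x').closure_eq, Metric.mem_closure_iff]
  intro ε hε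
  have hd := dist_pos_of_adj he.1
  obtain ⟨s, hs, hs'⟩ := exists_between
    (max_lt hpos (by linarith [div_pos hε hd] : edgeParam u v x - ε / dist u v < edgeParam u v x))
  have hs0 : 0 < s := (le_max_left _ _).trans_lt hs
  have hs1 : s < 1 := hs'.trans_le (edgeParam_mem he.1 hxe).2
  obtain ⟨y, hy, rfl⟩ := exists_edgeParam_eq he.1 (t := s) ⟨hs0.le, hs1.le⟩
  refine ⟨y, ((hr x').2 y hy ⟨hs0, hs1⟩).2 ?_, ?_⟩
  · rw [← h u v he r hr, hrx]
    exact hs'.le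
  · rw [dist_eq_edgeParam he.1 hxe hy, ← lt_div_iff₀ hd, abs_of_pos (by linarith)]
    linarith [(le_max_right _ _).trans_lt hs]

/-! ### Measures determined by real-valued functions with trivial products -/

/-- Products of different functions `r i` are zero or one of the factors, so that the algebra they
generate is spanned by `1` and their powers; it is dense by the Stone–Weierstrass theorem. -/
lemma measure_ext_of_map_eq {X ι : Type*} [TopologicalSpace X] [CompactSpace X]
    [MeasurableSpace X] [BorelSpace X] [HasOuterApproxClosed X] {μ ν : Measure X}
    [IsFiniteMeasure μ] [IsFiniteMeasure ν] (r : ι → C(X, ℝ))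
    (hsep : ∀ x y, (∀ i, r i x = r i y) → x = y)
    (hmul : ∀ i j, i ≠ j → r i * r j = 0 ∨ r i * r j = r j ∨ r i * r j = r i)
    (huniv : μ Set.univ = ν Set.univ) (hmap : ∀ i, μ.map (r i) = ν.map (r i)) : μ = ν := by
  have hint : ∀ (ρ : Measure X) [IsFiniteMeasure ρ] (f : C(X, ℝ)), Integrable f ρ := fun ρ _ f =>
    f.continuous.integrable_of_hasCompactSupport (HasCompactSupport.of_compactSpace f)
  let φ : (ρ : Measure X) → [IsFiniteMeasure ρ] → C(X, ℝ) →L[ℝ] ℝ := fun ρ _ =>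
    LinearMap.mkContinuous
      { toFun := fun f => ∫ x, f x ∂ρ
        map_add' := fun f g => integral_add (hint ρ f) (hint ρ g)
        map_smul' := fun c f => integral_const_mul c _ } (ρ.real Set.univ) fun f => by
      rw [mul_comm]
      exact norm_integral_le_of_norm_le_const (Filter.Eventually.of_forall f.norm_coe_le_norm)
  have hmon : ∀ f ∈ Submonoid.closure (Set.range r),
      f = 1 ∨ f = 0 ∨ ∃ i k, f = r i ^ (k + 1) := by
    intro f hf
    induction hf using Submonoid.closure_induction_left with
    | one => exact Or.inl rfl
    | mul_left g hg f _ ih =>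
      obtain ⟨i, rfl⟩ := hg
      right
      rcases ih with rfl | rfl | ⟨j, k, rfl⟩
      · exact Or.inr ⟨i, 0, by simp⟩
      · exact Or.inl (mul_zero _)
      · by_cases hij : i = j
        · subst hij
          exact Or.inr ⟨i, k + 1, (pow_succ' _ _).symm⟩
        · rcases hmul i j hij with h | h | h
          · left
            rw [pow_succ', ← mul_assoc, h, zero_mul]
          · right
            exact ⟨j, k, by rw [pow_succ', ← mul_assoc, h]⟩
          · right
            have habs : ∀ k : ℕ, r i * r j ^ (k + 1) = r i := fun k => by
              induction k with
              | zero => rw [zero_add, pow_one, h]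
              | succ k ih => rw [pow_succ, ← mul_assoc, ih, h]
            exact ⟨i, 0, by rw [habs, zero_add, pow_one]⟩
  have hpow : ∀ f ∈ Submonoid.closure (Set.range r), φ μ f = φ ν f := by
    intro f hf
    change ∫ x, f x ∂μ = ∫ x, f x ∂ν
    rcases hmon f hf with rfl | rfl | ⟨i, k, rfl⟩
    · simp [Measure.real, huniv]
    · simp
    · have hm : ∀ ρ : Measure X, ∫ x, (r i ^ (k + 1)) x ∂ρ = ∫ t, t ^ (k + 1) ∂(ρ.map (r i)) :=
        fun ρ => (integral_map (r i).continuous.measurable.aemeasurable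
          (continuous_pow (k + 1)).aestronglyMeasurable).symm
      rw [hm, hm, hmap]
  have hadj : ∀ f ∈ Algebra.adjoin ℝ (Set.range r), φ μ f = φ ν f := by
    intro f hf
    rw [← Subalgebra.mem_toSubmodule, Algebra.adjoin_eq_span] at hf
    induction hf using Submodule.span_induction with
    | mem f hf => exact hpow f hf
    | zero => simp
    | add f g _ _ hf hg => rw [map_add, map_add, hf, hg]
    | smul c f _ hf => rw [map_smul, map_smul, hf]
  have hdense : (Algebra.adjoin ℝ (Set.range r)).topologicalClosure = ⊤ := by
    refine ContinuousMap.subalgebra_topologicalClosure_eq_top_of_separatesPoints _ ?_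
    intro x y hxy
    by_contra hcon
    refine hxy (hsep x y fun i => ?_)
    by_contra hi
    exact hcon ⟨r i, ⟨r i, Algebra.subset_adjoin ⟨i, rfl⟩, rfl⟩, hi⟩
  have hall : ∀ f : C(X, ℝ), φ μ f = φ ν f := by
    intro f
    have hf : f ∈ (Algebra.adjoin ℝ (Set.range r)).topologicalClosure := hdense ▸ Algebra.mem_top
    exact closure_minimal (s := (Algebra.adjoin ℝ (Set.range r) : Set C(X, ℝ)))
      (t := {f | φ μ f = φ ν f}) hadj
      (isClosed_eq (φ μ).continuous (φ ν).continuous) hf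
  exact ext_of_forall_integral_eq_of_IsFiniteMeasure fun f => hall f.toContinuousMap

lemma integrable_of_continuous (μ : FiniteMeasure G.Point) {f : G.Point → ℝ} (hf : Continuous f) :
    Integrable f (μ : Measure G.Point) :=
  hf.integrable_of_hasCompactSupport (HasCompactSupport.of_compactSpace f)

/-! ### Critics that separate measures -/

lemma IsGraphDeriv.const_mul {ω : Measure G.Point} {z : G.Point} {q : ℝ≥0∞} {f h : G.Point → ℝ}
    (hf : G.IsGraphDeriv ω z q f h) (c : ℝ) :
    G.IsGraphDeriv ω z q (fun x => c * f x) (fun x => c * h x) := by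
  refine ⟨hf.1.const_mul c, fun x => ⟨(hf.2 x).1.const_mul c, ?_⟩⟩
  rw [integral_const_mul, ← (hf.2 x).2, mul_sub]

lemma isGraphDeriv_const (ω : Measure G.Point) (z : G.Point) (q : ℝ≥0∞) (c : ℝ) :
    G.IsGraphDeriv ω z q (fun _ => c) (fun _ => 0) :=
  ⟨MemLp.zero, fun x => ⟨integrableOn_zero, by simp⟩⟩

/-- Small multiples of `f` of either sign are critics. -/
lemma integral_eq_of_US_eq_zero {ω : Measure G.Point} {z : G.Point} {b lam α : ℝ}
    {w₁ w₂ : G.Point → ℝ} {p : ℝ≥0∞} (hb : 0 < b)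
    (hα : α < b * lam / 2 + min (w₁ z) (w₂ z)) {μ ν : FiniteMeasure G.Point}
    (hUS : G.US ω z b lam w₁ w₂ α p μ ν = 0) {f h : G.Point → ℝ} (hf : Continuous f)
    (hfh : G.IsGraphDeriv ω z p.conjExponent f h) :
    ∫ x, f x ∂(μ : Measure G.Point) = ∫ x, f x ∂(ν : Measure G.Point) := by
  have h1 : 0 < w₁ z + b * lam / 2 - α := by linarith [min_le_left (w₁ z) (w₂ z)]
  have h2 : 0 < w₂ z + b * lam / 2 - α := by linarith [min_le_right (w₁ z) (w₂ z)]
  set N : ℝ := (eLpNorm h p.conjExponent ω).toReal with hN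
  have hN0 : 0 ≤ N := ENNReal.toReal_nonneg
  set ε : ℝ := min (b / (N + 1))
    (min (w₁ z + b * lam / 2 - α) (w₂ z + b * lam / 2 - α) / (|f z| + 1)) with hε
  have hε0 : 0 < ε := lt_min (by positivity) (div_pos (lt_min h1 h2) (by positivity))
  have hεN : ε * N ≤ b := by
    have := mul_le_mul_of_nonneg_right (min_le_left _ _ : ε ≤ _) (by linarith : 0 ≤ N + 1)
    rw [div_mul_cancel₀ _ (by linarith)] at this
    linarith
  have hεf : ε * |f z| ≤ min (w₁ z + b * lam / 2 - α) (w₂ z + b * lam / 2 - α) := by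
    have := mul_le_mul_of_nonneg_right (min_le_right _ _ : ε ≤ _)
      (by positivity : 0 ≤ |f z| + 1)
    rw [div_mul_cancel₀ _ (by positivity)] at this
    linarith
  have key : ∀ c : ℝ, |c| = ε → c * (∫ x, f x ∂(μ : Measure G.Point) -
      ∫ x, f x ∂(ν : Measure G.Point)) ≤ 0 := by
    intro c hc
    have hcf : |c * f z| ≤ min (w₁ z + b * lam / 2 - α) (w₂ z + b * lam / 2 - α) := by
      rwa [abs_mul, hc]
    obtain ⟨h3, h4⟩ := abs_le.1 hcf
    have hmem : (fun x => c * f x) ∈ G.criticSet ω z b lam w₁ w₂ α p.conjExponent := by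
      refine ⟨continuous_const.mul hf, ⟨?_, ?_⟩, fun x => c * h x, hfh.const_mul c, ?_⟩
      · linarith [min_le_right (w₁ z + b * lam / 2 - α) (w₂ z + b * lam / 2 - α)]
      · linarith [min_le_left (w₁ z + b * lam / 2 - α) (w₂ z + b * lam / 2 - α)]
      · have : eLpNorm (fun x => c * h x) p.conjExponent ω =
            ENNReal.ofReal ε * eLpNorm h p.conjExponent ω := by
          rw [← hc, ← Real.norm_eq_abs, ofReal_norm]
          exact eLpNorm_const_smul c h _ _
        rw [this, ← ENNReal.ofReal_toReal hfh.1.2.ne, ← ENNReal.ofReal_mul hε0.le]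
        exact ENNReal.ofReal_le_ofReal hεN
    have hle : ((∫ x, c * f x ∂(μ : Measure G.Point) - ∫ x, c * f x ∂(ν : Measure G.Point) : ℝ) :
        EReal) ≤ 0 := by
      rw [← hUS]
      exact le_iSup₂ (f := fun f (_ : f ∈ G.criticSet ω z b lam w₁ w₂ α p.conjExponent) =>
        ((∫ x, f x ∂(μ : Measure G.Point) - ∫ x, f x ∂(ν : Measure G.Point) : ℝ) : EReal)) _ hmem
    rw [integral_const_mul, integral_const_mul, ← mul_sub] at hle
    exact_mod_cast hle
  have h5 := key ε (abs_of_pos hε0)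
  have h6 := key (-ε) (by rw [abs_neg, abs_of_pos hε0])
  nlinarith

/-- Between two coordinates `s₀ < s₁` of an outward edge there is a function with a graph
derivative that rises from `0` to `1`. Its derivative is a multiple of the indicator function of
a set without atoms, which makes it continuous. -/
lemma exists_step_function {z₀ u v : G.nodes} (hz : G.UniqueShortestPaths (G.nodePoint z₀))
    (he : IsOutward (G.nodePoint z₀) u v) {r : C(G.Point, ℝ)}
    (hr : IsEdgeRetraction (G.nodePoint z₀) u v r) {ω : Measure G.Point} [SigmaFinite ω]
    (hω : G.ChargesSegments ω) (q : ℝ≥0∞) {s₀ s₁ : ℝ} (h0 : 0 ≤ s₀) (h01 : s₀ < s₁)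
    (h1 : s₁ ≤ 1) :
    ∃ f h : G.Point → ℝ, Continuous f ∧ G.IsGraphDeriv ω (G.nodePoint z₀) q f h ∧
      ∀ x, f x ∈ Set.Icc (0 : ℝ) 1 ∧ (r x ≤ s₀ → f x = 0) ∧ (s₁ ≤ r x → f x = 1) := by
  obtain ⟨x₀, hx₀, hs₀⟩ := exists_edgeParam_eq he.1 (t := s₀) ⟨h0, h01.le.trans h1⟩
  obtain ⟨x₁, hx₁, hs₁⟩ := exists_edgeParam_eq he.1 (t := s₁) ⟨h0.trans h01.le, h1⟩
  have hx01 : x₀ ≠ x₁ := by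
    rintro rfl
    exact h01.ne (hs₀.symm.trans hs₁)
  have hcount : {a : G.Point | 0 < ω {a}}.Countable := by
    have := Measure.countable_meas_level_set_pos (μ := ω) (measurable_id (α := G.Point))
    simpa using this
  have hA : MeasurableSet {a | a ∈ G.lineSegment x₀ x₁ ∧ ω {a} = 0} := by
    have : {a | a ∈ G.lineSegment x₀ x₁ ∧ ω {a} = 0} =
        G.lineSegment x₀ x₁ \ {a | 0 < ω {a}} := by
      ext a
      simp
    rw [this]
    exact (isClosed_lineSegment _ _).measurableSet.diff hcount.measurableSet
  obtain ⟨T, hT, hTA, hT0, hTtop⟩ :=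
    Measure.exists_subset_measure_lt_top hA (hω u v he.1 x₀ x₁ hx₀ hx₁ hx01)
  have hTe : ∀ a ∈ T, (a : EuclideanSpace ℝ (Fin n)) ∈ G.edgeSegment u v ∧
      edgeParam u v a ∈ Set.Icc s₀ s₁ := by
    intro a ha
    have := (mem_lineSegment_iff he.1 hx₀ hx₁).1 (hTA ha).1
    rwa [hs₀, hs₁, Set.uIcc_of_le h01.le] at this
  have hTr : ∀ a ∈ T, r a = edgeParam u v a := fun a ha => hr.eq_edgeParam hz he (hTe a ha).1
  have hTnull : ∀ a, ω (T ∩ {a}) = 0 := by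
    intro a
    by_cases ha : a ∈ T
    · exact measure_mono_null Set.inter_subset_right (hTA ha).2
    · rw [Set.inter_singleton_eq_empty.2 ha, measure_empty]
  have hrm : Measurable r := r.continuous.measurable
  let m : Measure ℝ := (ω.restrict T).map r
  have hmB : ∀ B : Set ℝ, MeasurableSet B → m B = ω (T ∩ r ⁻¹' B) := fun B hB => by
    rw [Measure.map_apply hrm hB, Measure.restrict_apply (hrm hB), Set.inter_comm]
  have : IsFiniteMeasure (ω.restrict T) := isFiniteMeasure_restrict.2 hTtop.ne
  have : IsFiniteMeasure m := Measure.isFiniteMeasure_map _ _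
  have hmsing : ∀ s, m {s} = 0 := by
    intro s
    rw [hmB _ (measurableSet_singleton s)]
    by_cases hs : ∃ a ∈ T, r a = s
    · obtain ⟨a, ha, rfl⟩ := hs
      refine measure_mono_null ?_ (hTnull a)
      rintro c ⟨hc, hca⟩
      have hca : r c = r a := hca
      rw [hTr c hc, hTr a ha] at hca
      exact ⟨hc, eq_of_edgeParam_eq he.1 (hTe c hc).1 (hTe a ha).1 hca⟩
    · refine measure_mono_null ?_ measure_empty
      rintro c ⟨hc, hcs⟩
      exact hs ⟨c, hc, hcs⟩
  have : NullSingletonClass m := ⟨hmsing⟩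
  have hmIic : m (Set.Iic s₀) = 0 := by
    have : m (Set.Iio s₀) = 0 := by
      rw [hmB _ measurableSet_Iio]
      refine measure_mono_null ?_ measure_empty
      rintro c ⟨hc, hcs⟩
      have hcs : r c < s₀ := hcs
      rw [hTr c hc] at hcs
      exact absurd hcs (not_lt.2 (hTe c hc).2.1)
    rw [← Set.Iio_union_right]
    exact measure_union_null this (hmsing s₀)
  have hmIoi : m (Set.Ioi s₁) = 0 := by
    rw [hmB _ measurableSet_Ioi]
    refine measure_mono_null ?_ measure_empty
    rintro c ⟨hc, hcs⟩
    have hcs : s₁ < r c := hcs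
    rw [hTr c hc] at hcs
    exact absurd hcs (not_lt.2 (hTe c hc).2.2)
  have hmuniv : m Set.univ = ω T := by
    rw [hmB _ MeasurableSet.univ, Set.preimage_univ, Set.inter_univ]
  have hTreal : 0 < ω.real T := ENNReal.toReal_pos hT0.ne' hTtop.ne
  -- up to the end-points of the edge, which are null in `T`, the path `[z, x]` meets `T` in the
  -- points whose coordinate is at most `r x`
  have hpath : ∀ x, ω.real (T ∩ G.shortestPath (G.nodePoint z₀) x) =
      m.real (Set.Ioc 0 (r x)) := by
    intro x
    rw [Measure.real, Measure.real, hmB _ measurableSet_Ioc]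
    congr 1
    have hsub : ∀ a ∈ T, a ≠ G.nodePoint u → a ≠ G.nodePoint v →
        (a ∈ G.shortestPath (G.nodePoint z₀) x ↔ r a ∈ Set.Ioc 0 (r x)) := by
      intro a ha hau hav
      have hae := (hTe a ha).1
      have hτ := edgeParam_mem he.1 hae
      have h2 : 0 < edgeParam u v a := lt_of_le_of_ne hτ.1 fun h3 =>
        hau (eq_of_edgeParam_eq he.1 hae (nodePoint_left_mem u v) (by rw [← h3, edgeParam_left]))
      have h3 : edgeParam u v a < 1 := lt_of_le_of_ne hτ.2 fun h3 =>
        hav (eq_of_edgeParam_eq he.1 hae (nodePoint_right_mem u v)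
          (by rw [h3, edgeParam_right he.1]))
      rw [(hr x).2 a hae ⟨h2, h3⟩, hTr a ha]
      exact ⟨fun h => ⟨h2, h⟩, fun h => h.2⟩
    have hN : ω (T ∩ {G.nodePoint u} ∪ T ∩ {G.nodePoint v}) = 0 :=
      measure_union_null (hTnull _) (hTnull _)
    refine measure_congr ?_
    filter_upwards [measure_eq_zero_iff_ae_notMem.1 hN] with a ha
    refine propext (and_congr_right fun haT => hsub a haT ?_ ?_)
    · exact fun h => ha (Or.inl ⟨haT, h⟩)
    · exact fun h => ha (Or.inr ⟨haT, h⟩)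
  have hint : ∀ a b : ℝ, IntervalIntegrable (fun _ => (1 : ℝ)) m a b :=
    fun a b => intervalIntegrable_const
  have hmr : ∀ x, ∫ _ in (0 : ℝ)..r x, (1 : ℝ) ∂m = m.real (Set.Ioc 0 (r x)) := by
    intro x
    rw [intervalIntegral.integral_of_le (hr x).1.1]
    simp
  have hroot0 : r (G.nodePoint z₀) = 0 := hr.eq_zero_root hz he.1
  refine ⟨fun x => (ω.real T)⁻¹ * m.real (Set.Ioc 0 (r x)),
    T.indicator fun _ => (ω.real T)⁻¹, ?_, ⟨?_, fun x => ⟨?_, ?_⟩⟩, fun x => ⟨⟨?_, ?_⟩, ?_, ?_⟩⟩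
  · simp_rw [← hmr]
    exact continuous_const.mul ((intervalIntegral.continuous_primitive hint 0).comp r.continuous)
  · exact memLp_indicator_const q hT _ (Or.inr hTtop.ne)
  · exact ((integrable_indicator_iff hT).2 (integrableOn_const hTtop.ne)).integrableOn
  · beta_reduce
    rw [setIntegral_indicator hT, setIntegral_const, Set.inter_comm, hpath x, hroot0,
      Set.Ioc_self, measureReal_empty, mul_zero, sub_zero, smul_eq_mul, mul_comm]
  · positivity
  · rw [inv_mul_le_one₀ hTreal]
    have : m.real (Set.Ioc 0 (r x)) ≤ m.real Set.univ := measureReal_mono (Set.subset_univ _)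
    rwa [Measure.real, Measure.real, hmuniv] at this
  · intro hx
    have : m (Set.Ioc 0 (r x)) = 0 := measure_mono_null (fun t ht => ht.2.trans hx) hmIic
    simp [Measure.real, this]
  · intro hx
    have : m (Set.Ioc 0 (r x)) = ω T := by
      rw [← hmuniv]
      refine measure_eq_measure_of_null_sdiff (Set.subset_univ _) ?_
      refine measure_mono_null ?_ (measure_union_null hmIic hmIoi)
      rintro t ⟨-, ht⟩
      by_cases ht0 : t ≤ s₀
      · exact Or.inl ht0
      · exact Or.inr (not_le.1 fun h2 => ht ⟨h0.trans_lt (not_le.1 ht0), h2.trans hx⟩)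
    simp only [Measure.real, this]
    exact inv_mul_cancel₀ hTreal.ne'

/-! ### Separation of measures -/

/-- The step functions approximate the indicator function of `{r > s}` from below. -/
lemma measure_retraction_gt_eq {z₀ u v : G.nodes} (hz : G.UniqueShortestPaths (G.nodePoint z₀))
    (he : IsOutward (G.nodePoint z₀) u v) {r : C(G.Point, ℝ)}
    (hr : IsEdgeRetraction (G.nodePoint z₀) u v r) {ω : Measure G.Point} [SigmaFinite ω]
    (hω : G.ChargesSegments ω) (q : ℝ≥0∞) {μ ν : FiniteMeasure G.Point}
    (hμν : ∀ f h : G.Point → ℝ, Continuous f → G.IsGraphDeriv ω (G.nodePoint z₀) q f h →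
      ∫ x, f x ∂(μ : Measure G.Point) = ∫ x, f x ∂(ν : Measure G.Point))
    {s : ℝ} (h0 : 0 ≤ s) (h1 : s < 1) :
    (μ : Measure G.Point) (r ⁻¹' Set.Ioi s) = (ν : Measure G.Point) (r ⁻¹' Set.Ioi s) := by
  have hpos : ∀ k : ℕ, (0 : ℝ) < 1 / ((k : ℝ) + 1) := fun k => Nat.one_div_pos_of_nat
  have hle : ∀ k : ℕ, (1 : ℝ) / ((k : ℝ) + 1) ≤ 1 := fun k => by
    rw [div_le_one (by positivity)]
    linarith [(Nat.cast_nonneg k : (0 : ℝ) ≤ k)]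
  have hs1 : 0 < 1 - s := sub_pos.2 h1
  choose f h hf hfh hfr using fun k : ℕ => exists_step_function hz he hr hω q h0
    (by linarith [mul_pos hs1 (hpos k)] : s < s + (1 - s) * (1 / ((k : ℝ) + 1)))
    (by linarith [mul_le_mul_of_nonneg_left (hle k) hs1.le])
  have hm : MeasurableSet (r ⁻¹' Set.Ioi s) := (isOpen_Ioi.preimage r.continuous).measurableSet
  have hlim : ∀ x, Filter.Tendsto (fun k => f k x) Filter.atTop
      (nhds ((r ⁻¹' Set.Ioi s).indicator (fun _ => (1 : ℝ)) x)) := by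
    intro x
    by_cases hx : r x ≤ s
    · rw [Set.indicator_of_notMem (show x ∉ r ⁻¹' Set.Ioi s from not_lt.2 hx)]
      simp_rw [fun k => (hfr k x).2.1 hx]
      exact tendsto_const_nhds
    · have hx' := not_le.1 hx
      rw [Set.indicator_of_mem (show x ∈ r ⁻¹' Set.Ioi s from hx')]
      have ht : Filter.Tendsto (fun k : ℕ => s + (1 - s) * (1 / ((k : ℝ) + 1))) Filter.atTop
          (nhds s) := by
        simpa using (tendsto_one_div_add_atTop_nhds_zero_nat.const_mul (1 - s)).const_add s
      refine tendsto_const_nhds.congr' ?_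
      filter_upwards [ht.eventually_lt_const hx'] with k hk
      exact ((hfr k x).2.2 hk.le).symm
  have hdct : ∀ ρ : FiniteMeasure G.Point, Filter.Tendsto
      (fun k => ∫ x, f k x ∂(ρ : Measure G.Point)) Filter.atTop
      (nhds ((ρ : Measure G.Point).real (r ⁻¹' Set.Ioi s))) := by
    intro ρ
    have := tendsto_integral_of_dominated_convergence (μ := (ρ : Measure G.Point))
      (F := fun k x => f k x) (fun _ => (1 : ℝ))
      (fun k => (hf k).aestronglyMeasurable) (integrable_const _)
      (fun k => Filter.Eventually.of_forall fun x => by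
        rw [Real.norm_of_nonneg (hfr k x).1.1]
        exact (hfr k x).1.2) (Filter.Eventually.of_forall hlim)
    simpa [integral_indicator hm] using this
  have := tendsto_nhds_unique (hdct μ) ((hdct ν).congr fun k => (hμν _ _ (hf k) (hfh k)).symm)
  exact (measureReal_eq_measureReal_iff).1 this

lemma eq_of_forall_isGraphDeriv {z₀ : G.nodes} (hz : G.UniqueShortestPaths (G.nodePoint z₀))
    {ω : Measure G.Point} [SigmaFinite ω] (hω : G.ChargesSegments ω) (q : ℝ≥0∞)
    {μ ν : FiniteMeasure G.Point}
    (hμν : ∀ f h : G.Point → ℝ, Continuous f → G.IsGraphDeriv ω (G.nodePoint z₀) q f h →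
      ∫ x, f x ∂(μ : Measure G.Point) = ∫ x, f x ∂(ν : Measure G.Point)) : μ = ν := by
  have huniv : (μ : Measure G.Point) Set.univ = (ν : Measure G.Point) Set.univ := by
    have := hμν _ _ continuous_const (isGraphDeriv_const ω (G.nodePoint z₀) q 1)
    simp only [integral_const, smul_eq_mul, mul_one] at this
    exact (measureReal_eq_measureReal_iff).1 this
  choose r hr using fun e : {e : G.nodes × G.nodes // IsOutward (G.nodePoint z₀) e.1 e.2} =>
    exists_isEdgeRetraction hz e.2
  refine Subtype.ext (measure_ext_of_map_eq (μ := (μ : Measure G.Point))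
    (ν := (ν : Measure G.Point)) r ?_ ?_ huniv ?_)
  · intro x y hxy
    -- retractions are unique, so that it suffices to compare the chosen ones
    have hxy' : ∀ u v, IsOutward (G.nodePoint z₀) u v → ∀ r' : G.Point → ℝ,
        IsEdgeRetraction (G.nodePoint z₀) u v r' → r' x = r' y := by
      intro u v he r' hr'
      have heq : ∀ a, r' a = r ⟨(u, v), he⟩ a := fun a =>
        eq_of_interior_le_iff he.1 (hr' a).1 (hr ⟨(u, v), he⟩ a).1 fun c hc hτ => by
          rw [← (hr' a).2 c hc hτ, ← (hr ⟨(u, v), he⟩ a).2 c hc hτ]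
      rw [heq, heq, hxy]
    exact hz.eq_of_mem_of_mem
      (mem_shortestPath_of_retractions_eq hz fun u v he r' hr' => (hxy' u v he r' hr').symm)
      (mem_shortestPath_of_retractions_eq hz hxy')
  · intro i j hij
    have hne : (i.1.1, i.1.2) ≠ (j.1.1, j.1.2) := fun h => hij (Subtype.ext h)
    exact ((hr i).mul_eq hz i.2 j.2 hne (hr j)).imp (fun h => ContinuousMap.ext h)
      (Or.imp (fun h => ContinuousMap.ext h) fun h => ContinuousMap.ext h)
  · intro e
    have hgt : ∀ s : ℝ, (μ : Measure G.Point) (r e ⁻¹' Set.Ioi s) =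
        (ν : Measure G.Point) (r e ⁻¹' Set.Ioi s) := by
      intro s
      rcases lt_or_ge s 0 with h0 | h0
      · have : r e ⁻¹' Set.Ioi s = Set.univ :=
          Set.eq_univ_of_forall fun x => h0.trans_le (hr e x).1.1
        rw [this, huniv]
      rcases lt_or_ge s 1 with h1 | h1
      · exact measure_retraction_gt_eq hz e.2 (hr e) hω q hμν h0 h1
      · have : r e ⁻¹' Set.Ioi s = ∅ :=
          Set.eq_empty_of_forall_notMem fun x hx => absurd ((hr e x).1.2.trans h1) (not_le.2 hx)
        rw [this, measure_empty, measure_empty]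
    have hrm : Measurable (r e) := (r e).continuous.measurable
    refine Measure.ext_of_Iic _ _ fun s => ?_
    have hc : r e ⁻¹' Set.Iic s = (r e ⁻¹' Set.Ioi s)ᶜ := by
      rw [← Set.preimage_compl, Set.compl_Ioi]
    rw [Measure.map_apply hrm measurableSet_Iic, Measure.map_apply hrm measurableSet_Iic, hc,
      measure_compl (hrm measurableSet_Ioi) (measure_ne_top _ _),
      measure_compl (hrm measurableSet_Ioi) (measure_ne_top _ _), huniv, hgt]

/-! ### The metric defined by a symmetric class of test functions -/

/-- A bounded sequence of finite measures on a compact space has a weak limit along an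
ultrafilter. -/
lemma exists_tendsto_hyperfilter {X : Type*} [TopologicalSpace X] [T2Space X] [CompactSpace X]
    [MeasurableSpace X] [BorelSpace X] (u : ℕ → FiniteMeasure X) (C : NNReal)
    (hu : ∀ k, (u k).mass ≤ C) :
    ∃ μ : FiniteMeasure X, ∀ f : X → ℝ, Continuous f →
      Filter.Tendsto (fun k => ∫ x, f x ∂(u k : Measure X)) (Filter.hyperfilter ℕ : Filter ℕ)
        (nhds (∫ x, f x ∂(μ : Measure X))) := by
  obtain ⟨μ, -, hμ⟩ :=
    (isCompact_setOfPred_finiteMeasure_le_of_compactSpace X C).ultrafilter_le_nhds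
    ((Filter.hyperfilter ℕ).map u)
    (Filter.le_principal_iff.2 (Filter.mem_map.2 (Filter.univ_mem' hu)))
  refine ⟨μ, fun f hf => ?_⟩
  exact FiniteMeasure.tendsto_iff_forall_integral_tendsto.1 hμ
    (BoundedContinuousFunction.mkOfCompact ⟨f, hf⟩)

/-- The metric on finite measures that is dual to a symmetric, uniformly bounded and separating
class `K` of continuous functions with a positive constant. It is complete since it is lower
semicontinuous for weak convergence, and geodesic since it only depends on the difference of the
measures and scales with it. -/
lemma exists_metricSpace {X : Type*} [TopologicalSpace X] [T2Space X] [CompactSpace X]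
    [MeasurableSpace X] [BorelSpace X] {K : Set (X → ℝ)} (hcont : ∀ f ∈ K, Continuous f)
    (hneg : ∀ f ∈ K, (fun x => -f x) ∈ K) {B : ℝ} (hB : ∀ f ∈ K, ∀ x, |f x| ≤ B)
    {c : ℝ} (hc : 0 < c) (hcK : (fun _ => c) ∈ K)
    (hsep : ∀ μ ν : FiniteMeasure X,
      (∀ f ∈ K, ∫ x, f x ∂(μ : Measure X) = ∫ x, f x ∂(ν : Measure X)) → μ = ν) :
    ∃ m : MetricSpace (FiniteMeasure X),
      (∀ μ ν : FiniteMeasure X, ((m.dist μ ν : ℝ) : EReal) =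
        ⨆ f ∈ K, ((∫ x, f x ∂(μ : Measure X) - ∫ x, f x ∂(ν : Measure X) : ℝ) : EReal)) ∧
      @CompleteSpace (FiniteMeasure X) m.toUniformSpace ∧
      ∀ μ ν : FiniteMeasure X, ∃ φ : ℝ → FiniteMeasure X, φ 0 = μ ∧ φ (m.dist μ ν) = ν ∧
        ∀ s ∈ Set.Icc 0 (m.dist μ ν), ∀ t ∈ Set.Icc 0 (m.dist μ ν),
          m.dist (φ t) (φ s) = |t - s| := by
  let S : FiniteMeasure X → FiniteMeasure X → EReal := fun μ ν =>
    ⨆ f ∈ K, ((∫ x, f x ∂(μ : Measure X) - ∫ x, f x ∂(ν : Measure X) : ℝ) : EReal)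
  let d : FiniteMeasure X → FiniteMeasure X → ℝ := fun μ ν => (S μ ν).toReal
  have hint : ∀ (ρ : FiniteMeasure X), ∀ f ∈ K, Integrable f (ρ : Measure X) := fun ρ f hf =>
    (hcont f hf).integrable_of_hasCompactSupport (HasCompactSupport.of_compactSpace f)
  have hbd : ∀ (ρ : FiniteMeasure X), ∀ f ∈ K,
      |∫ x, f x ∂(ρ : Measure X)| ≤ B * (ρ : Measure X).real Set.univ := fun ρ f hf => by
    rw [← Real.norm_eq_abs]
    exact norm_integral_le_of_norm_le_const (Filter.Eventually.of_forall (hB f hf))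
  have hSd : ∀ μ ν, ((d μ ν : ℝ) : EReal) = S μ ν := by
    intro μ ν
    refine EReal.coe_toReal (ne_top_of_le_ne_top (EReal.coe_ne_top
      (B * (μ : Measure X).real Set.univ + B * (ν : Measure X).real Set.univ)) ?_)
      (ne_bot_of_le_ne_bot (EReal.coe_ne_bot _) (le_iSup₂ (f := fun f (_ : f ∈ K) =>
        ((∫ x, f x ∂(μ : Measure X) - ∫ x, f x ∂(ν : Measure X) : ℝ) : EReal)) _ hcK))
    refine iSup₂_le fun f hf => EReal.coe_le_coe_iff.2 ?_
    linarith [abs_le.1 (hbd μ f hf), abs_le.1 (hbd ν f hf)]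
  have hle : ∀ μ ν : FiniteMeasure X, ∀ f ∈ K,
      ∫ x, f x ∂(μ : Measure X) - ∫ x, f x ∂(ν : Measure X) ≤ d μ ν := by
    intro μ ν f hf
    rw [← EReal.coe_le_coe_iff, hSd]
    exact le_iSup₂ (f := fun f (_ : f ∈ K) =>
      ((∫ x, f x ∂(μ : Measure X) - ∫ x, f x ∂(ν : Measure X) : ℝ) : EReal)) f hf
  have hge : ∀ (μ ν : FiniteMeasure X) (a : ℝ),
      (∀ f ∈ K, ∫ x, f x ∂(μ : Measure X) - ∫ x, f x ∂(ν : Measure X) ≤ a) → d μ ν ≤ a := by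
    intro μ ν a h
    rw [← EReal.coe_le_coe_iff, hSd]
    exact iSup₂_le fun f hf => EReal.coe_le_coe_iff.2 (h f hf)
  have habs : ∀ μ ν : FiniteMeasure X, ∀ f ∈ K,
      |∫ x, f x ∂(μ : Measure X) - ∫ x, f x ∂(ν : Measure X)| ≤ d μ ν := by
    intro μ ν f hf
    refine abs_le'.2 ⟨hle μ ν f hf, ?_⟩
    have := hle μ ν _ (hneg f hf)
    rw [integral_neg, integral_neg] at this
    linarith
  have hnonneg : ∀ μ ν, 0 ≤ d μ ν := fun μ ν => (abs_nonneg _).trans (habs μ ν _ hcK)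
  have hself : ∀ μ, d μ μ = 0 := fun μ =>
    le_antisymm (hge μ μ 0 fun f _ => (sub_self _).le) (hnonneg μ μ)
  have hcomm : ∀ μ ν, d μ ν ≤ d ν μ := fun μ ν =>
    hge μ ν _ fun f hf => by linarith [neg_abs_le (∫ x, f x ∂(ν : Measure X) -
      ∫ x, f x ∂(μ : Measure X)), habs ν μ f hf]
  have htri : ∀ μ σ ν, d μ ν ≤ d μ σ + d σ ν := fun μ σ ν =>
    hge μ ν _ fun f hf => by linarith [hle μ σ f hf, hle σ ν f hf]
  let m : MetricSpace (FiniteMeasure X) :=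
    { dist := d
      dist_self := hself
      dist_comm := fun μ ν => le_antisymm (hcomm μ ν) (hcomm ν μ)
      dist_triangle := htri
      eq_of_dist_eq_zero := fun {μ ν} h => hsep μ ν fun f hf => by
        have := habs μ ν f hf
        rw [show d μ ν = 0 from h] at this
        exact sub_eq_zero.1 (abs_nonpos_iff.1 this) }
  refine ⟨m, hSd, ?_, ?_⟩
  · refine @Metric.complete_of_cauchySeq_tendsto _ m.toPseudoMetricSpace fun u hu => ?_
    have hu' : ∀ ε > 0, ∃ N : ℕ, ∀ k ≥ N, ∀ l ≥ N, d (u k) (u l) < ε :=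
      (@Metric.cauchySeq_iff _ ℕ m.toPseudoMetricSpace _ _ u).1 hu
    -- the constant `c` in `K` bounds the masses along the sequence
    have hmass : ∃ (N : ℕ) (C : NNReal), ∀ k, (u (N + k)).mass ≤ C := by
      obtain ⟨N, hN⟩ := hu' c hc
      refine ⟨N, (u N).mass + 1, fun k => ?_⟩
      have h1 := (hle (u (N + k)) (u N) _ hcK).trans (hN (N + k) (by omega) N le_rfl).le
      have hreal : ∀ ρ : FiniteMeasure X, (ρ : Measure X).real Set.univ = ρ.mass := fun ρ => rfl
      simp only [integral_const, smul_eq_mul, hreal] at h1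
      rw [← NNReal.coe_le_coe]
      push_cast
      nlinarith
    obtain ⟨N, C, hC⟩ := hmass
    obtain ⟨μ, hμ⟩ := exists_tendsto_hyperfilter (fun k => u (N + k)) C hC
    refine ⟨μ, (@Metric.tendsto_atTop _ ℕ m.toPseudoMetricSpace _ _ u μ).2 fun ε hε => ?_⟩
    obtain ⟨M, hM⟩ := hu' (ε / 2) (half_pos hε)
    refine ⟨M, fun k hk => lt_of_le_of_lt (hge (u k) μ (ε / 2) fun f hf => ?_) (half_lt_self hε)⟩
    refine le_of_tendsto (tendsto_const_nhds.sub (hμ f (hcont f hf))) ?_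
    refine Filter.Eventually.filter_mono Nat.hyperfilter_le_atTop ?_
    filter_upwards [Filter.eventually_ge_atTop M] with l hl
    exact (hle _ _ f hf).trans (hM k hk (N + l) (by omega)).le
  · intro μ ν
    change ∃ φ : ℝ → FiniteMeasure X, φ 0 = μ ∧ φ (d μ ν) = ν ∧
      ∀ s ∈ Set.Icc 0 (d μ ν), ∀ t ∈ Set.Icc 0 (d μ ν), d (φ t) (φ s) = |t - s|
    rcases (hnonneg μ ν).eq_or_lt with h0 | h0
    · have hμν : μ = ν := m.eq_of_dist_eq_zero h0.symm
      refine ⟨fun _ => μ, rfl, hμν, fun s hs t ht => ?_⟩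
      rw [← h0] at hs ht
      rw [hself, le_antisymm hs.2 hs.1, le_antisymm ht.2 ht.1, sub_self, abs_zero]
    · set a := d μ ν with ha
      let φ : ℝ → FiniteMeasure X := fun t =>
        Real.toNNReal (1 - t / a) • μ + Real.toNNReal (t / a) • ν
      have hφ0 : φ 0 = μ := by simp [φ]
      have hφa : φ a = ν := by simp [φ, div_self h0.ne']
      have hφ : ∀ t ∈ Set.Icc 0 a, ∀ f ∈ K, ∫ x, f x ∂(φ t : Measure X) =
          (1 - t / a) * ∫ x, f x ∂(μ : Measure X) + t / a * ∫ x, f x ∂(ν : Measure X) := by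
        intro t ht f hf
        have h1 : 0 ≤ t / a := div_nonneg ht.1 h0.le
        have h2 : 0 ≤ 1 - t / a := sub_nonneg.2 ((div_le_one h0).2 ht.2)
        simp only [φ, FiniteMeasure.toMeasure_add, FiniteMeasure.toMeasure_smul]
        rw [integral_add_measure ((hint μ f hf).smul_measure_nnreal)
          ((hint ν f hf).smul_measure_nnreal), integral_smul_nnreal_measure,
          integral_smul_nnreal_measure, NNReal.smul_def, NNReal.smul_def,
          Real.coe_toNNReal _ h1, Real.coe_toNNReal _ h2, smul_eq_mul, smul_eq_mul]
      have hupper : ∀ s ∈ Set.Icc 0 a, ∀ t ∈ Set.Icc 0 a, d (φ t) (φ s) ≤ |t - s| := by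
        intro s hs t ht
        refine hge _ _ _ fun f hf => ?_
        rw [hφ t ht f hf, hφ s hs f hf]
        calc _ = (s - t) / a * (∫ x, f x ∂(μ : Measure X) - ∫ x, f x ∂(ν : Measure X)) := by ring
          _ ≤ |(s - t) / a * (∫ x, f x ∂(μ : Measure X) - ∫ x, f x ∂(ν : Measure X))| :=
            le_abs_self _
          _ ≤ |(s - t) / a| * a := by
            rw [abs_mul]
            exact mul_le_mul_of_nonneg_left (habs μ ν f hf) (abs_nonneg _)
          _ = |t - s| := by rw [abs_div, abs_of_pos h0, div_mul_cancel₀ _ h0.ne', abs_sub_comm]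
      -- the upper bounds add up to `a`, so that none of them can be strict
      have hlower : ∀ s ∈ Set.Icc 0 a, ∀ t ∈ Set.Icc 0 a, s ≤ t → |t - s| ≤ d (φ s) (φ t) := by
        intro s hs t ht hst
        have h1 := hupper s hs 0 ⟨le_rfl, h0.le⟩
        have h2 := hupper a ⟨h0.le, le_rfl⟩ t ht
        have h3 := htri μ (φ s) ν
        have h4 := htri (φ s) (φ t) ν
        rw [hφ0, zero_sub, abs_neg, abs_of_nonneg hs.1] at h1
        rw [hφa, abs_sub_comm, abs_of_nonneg (sub_nonneg.2 ht.2)] at h2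
        rw [abs_of_nonneg (sub_nonneg.2 hst)]
        linarith
      refine ⟨φ, hφ0, hφa, fun s hs t ht => le_antisymm (hupper s hs t ht) ?_⟩
      rcases le_total s t with hst | hst
      · exact (hlower s hs t ht hst).trans (hcomm _ _)
      · rw [abs_sub_comm]
        exact hlower t ht s hs hst

/-! ### Critics for a finite measure -/

lemma neg_mem_criticSet {ω : Measure G.Point} {z : G.Point} {b lam α : ℝ} {w₁ w₂ : G.Point → ℝ}
    {q : ℝ≥0∞} (hw : w₁ z = w₂ z) {f : G.Point → ℝ}
    (hf : f ∈ G.criticSet ω z b lam w₁ w₂ α q) :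
    (fun x => -f x) ∈ G.criticSet ω z b lam w₁ w₂ α q := by
  obtain ⟨hfc, ⟨h1, h2⟩, h, hh, hb⟩ := hf
  refine ⟨hfc.neg, ⟨by linarith, by linarith⟩, fun x => -h x, ?_, ?_⟩
  · simpa using hh.const_mul (-1)
  · rwa [show (fun x => -h x) = -h from rfl, eLpNorm_neg]

lemma const_mem_criticSet (ω : Measure G.Point) {z : G.Point} {b lam α : ℝ} {w₁ w₂ : G.Point → ℝ}
    (q : ℝ≥0∞) {c : ℝ} (hc : c ∈ Set.Icc (-w₂ z - b * lam / 2 + α) (w₁ z + b * lam / 2 - α)) :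
    (fun _ => c) ∈ G.criticSet ω z b lam w₁ w₂ α q :=
  ⟨continuous_const, hc, fun _ => 0, isGraphDeriv_const ω z q c, by simp⟩

/-- By Hölder's inequality, the graph derivatives are bounded in `L¹(ω)`. -/
lemma exists_bound_criticSet (ω : Measure G.Point) [IsFiniteMeasure ω] (z : G.Point)
    (b lam α : ℝ) (w₁ w₂ : G.Point → ℝ) {q : ℝ≥0∞} (hq : 1 ≤ q) :
    ∃ B : ℝ, ∀ f ∈ G.criticSet ω z b lam w₁ w₂ α q, ∀ x, |f x| ≤ B := by
  set L : ℝ≥0∞ := ENNReal.ofReal b * ω Set.univ ^ (1 / (1 : ℝ≥0∞).toReal - 1 / q.toReal) with hL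
  have hq' : 0 ≤ 1 / (1 : ℝ≥0∞).toReal - 1 / q.toReal := by
    rcases eq_or_ne q ∞ with rfl | hqt
    · simp
    · have : 1 ≤ q.toReal := by
        rw [← ENNReal.toReal_one]
        exact ENNReal.toReal_mono hqt hq
      rw [ENNReal.toReal_one, div_one, sub_nonneg]
      exact (div_le_one (by linarith)).2 this
  have hLtop : L ≠ ∞ :=
    ENNReal.mul_ne_top ENNReal.ofReal_ne_top
      (ENNReal.rpow_ne_top_of_nonneg hq' (measure_ne_top _ _))
  refine ⟨max |-w₂ z - b * lam / 2 + α| |w₁ z + b * lam / 2 - α| + L.toReal, ?_⟩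
  rintro f ⟨-, hfz, h, hh, hb⟩ x
  have h1 : eLpNorm h 1 ω ≤ L :=
    (eLpNorm_le_eLpNorm_mul_rpow_measure_univ hq hh.1.1).trans (mul_le_mul' hb le_rfl)
  have hi : Integrable h ω := memLp_one_iff_integrable.1 (hh.1.mono_exponent hq)
  have h2 : |f x - f z| ≤ L.toReal := by
    rw [(hh.2 x).2]
    calc |∫ y in G.shortestPath z x, h y ∂ω| ≤ ∫ y in G.shortestPath z x, ‖h y‖ ∂ω :=
        (Real.norm_eq_abs _).symm.le.trans (norm_integral_le_integral_norm _)
      _ ≤ ∫ y, ‖h y‖ ∂ω := setIntegral_le_integral hi.norm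
        (Filter.Eventually.of_forall fun y => norm_nonneg _)
      _ = (eLpNorm h 1 ω).toReal := by
        rw [eLpNorm_one_eq_lintegral_enorm, integral_norm_eq_lintegral_enorm hi.1]
      _ ≤ L.toReal := ENNReal.toReal_mono hLtop h1
  have h3 := abs_le_max_abs_abs hfz.1 hfz.2
  calc |f x| = |f z + (f x - f z)| := by rw [add_sub_cancel]
    _ ≤ |f z| + |f x - f z| := abs_add_le _ _
    _ ≤ _ := add_le_add h3 h2

end PhysicalGraph

theorem proposition5p1 {n : ℕ} (G : PhysicalGraph n) (z₀ : G.nodes)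
    (hroot : G.UniqueShortestPaths (G.nodePoint z₀))
    (ω : Measure G.Point) (b lam : ℝ) (hb : 0 ≤ b) (hlam : 0 ≤ lam)
    (w₁ w₂ : G.Point → ℝ) (hw₁ : 0 ≤ w₁ (G.nodePoint z₀)) (hw₂ : 0 ≤ w₂ (G.nodePoint z₀))
    (p : ℝ≥0∞) (hp : 1 ≤ p) (α : ℝ) (hα₀ : 0 ≤ α)
    (hα : α < b * lam / 2 + min (w₁ (G.nodePoint z₀)) (w₂ (G.nodePoint z₀))) :
    -- invariance under adding a common measure
    (∀ μ ν σ : FiniteMeasure G.Point,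
      G.US ω (G.nodePoint z₀) b lam w₁ w₂ α p (μ + σ) (ν + σ) =
        G.US ω (G.nodePoint z₀) b lam w₁ w₂ α p μ ν) ∧
    -- nonnegativity, vanishing on the diagonal, triangle inequality
    ((∀ μ ν : FiniteMeasure G.Point, 0 ≤ G.US ω (G.nodePoint z₀) b lam w₁ w₂ α p μ ν) ∧
      (∀ μ : FiniteMeasure G.Point, G.US ω (G.nodePoint z₀) b lam w₁ w₂ α p μ μ = 0) ∧
      (∀ μ ν σ : FiniteMeasure G.Point,
        G.US ω (G.nodePoint z₀) b lam w₁ w₂ α p μ ν ≤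
          G.US ω (G.nodePoint z₀) b lam w₁ w₂ α p μ σ +
            G.US ω (G.nodePoint z₀) b lam w₁ w₂ α p σ ν)) ∧
    -- separation
    (0 < b → SigmaFinite ω → G.ChargesSegments ω → ∀ μ ν : FiniteMeasure G.Point,
      G.US ω (G.nodePoint z₀) b lam w₁ w₂ α p μ ν = 0 ↔ μ = ν) ∧
    -- complete geodesic metric space
    (0 < b → IsFiniteMeasure ω → G.ChargesSegments ω →
      w₁ (G.nodePoint z₀) = w₂ (G.nodePoint z₀) →
      ∃ m : MetricSpace (FiniteMeasure G.Point),
        (∀ μ ν : FiniteMeasure G.Point,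
          ((m.dist μ ν : ℝ) : EReal) = G.US ω (G.nodePoint z₀) b lam w₁ w₂ α p μ ν) ∧
        @CompleteSpace (FiniteMeasure G.Point) m.toUniformSpace ∧
        ∀ μ ν : FiniteMeasure G.Point, ∃ φ : ℝ → FiniteMeasure G.Point,
          φ 0 = μ ∧ φ (m.dist μ ν) = ν ∧
          ∀ s ∈ Set.Icc 0 (m.dist μ ν), ∀ t ∈ Set.Icc 0 (m.dist μ ν),
            m.dist (φ t) (φ s) = |t - s|) := by
  set z := G.nodePoint z₀ with hzdef
  have h0mem : (fun _ => 0) ∈ G.criticSet ω z b lam w₁ w₂ α p.conjExponent :=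
    PhysicalGraph.const_mem_criticSet ω _
      ⟨by linarith [min_le_right (w₁ z) (w₂ z)], by linarith [min_le_left (w₁ z) (w₂ z)]⟩
  have hle : ∀ (μ ν : FiniteMeasure G.Point),
      ∀ f ∈ G.criticSet ω z b lam w₁ w₂ α p.conjExponent,
        ((∫ x, f x ∂(μ : Measure G.Point) - ∫ x, f x ∂(ν : Measure G.Point) : ℝ) : EReal) ≤
          G.US ω z b lam w₁ w₂ α p μ ν := fun μ ν f hf =>
    le_iSup₂ (f := fun f (_ : f ∈ G.criticSet ω z b lam w₁ w₂ α p.conjExponent) =>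
      ((∫ x, f x ∂(μ : Measure G.Point) - ∫ x, f x ∂(ν : Measure G.Point) : ℝ) : EReal)) f hf
  have hself : ∀ μ : FiniteMeasure G.Point, G.US ω z b lam w₁ w₂ α p μ μ = 0 := fun μ =>
    le_antisymm (iSup₂_le fun f _ => by simp) (by simpa using hle μ μ _ h0mem)
  have hsep : 0 < b → SigmaFinite ω → G.ChargesSegments ω → ∀ μ ν : FiniteMeasure G.Point,
      G.US ω z b lam w₁ w₂ α p μ ν = 0 → μ = ν := fun hb' _ hω μ ν h =>
    PhysicalGraph.eq_of_forall_isGraphDeriv hroot hω p.conjExponent fun f h' hf hfh =>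
      PhysicalGraph.integral_eq_of_US_eq_zero hb' hα h hf hfh
  refine ⟨fun μ ν σ => ?_, ⟨fun μ ν => ?_, hself, fun μ ν σ => ?_⟩, fun hb' hσ hω μ ν => ?_, ?_⟩
  · refine iSup_congr fun f => iSup_congr fun hf => ?_
    have hi := fun ρ : FiniteMeasure G.Point => PhysicalGraph.integrable_of_continuous ρ hf.1
    rw [FiniteMeasure.toMeasure_add, FiniteMeasure.toMeasure_add,
      integral_add_measure (hi μ) (hi σ), integral_add_measure (hi ν) (hi σ),
      add_sub_add_right_eq_sub]
  · simpa using hle μ ν _ h0mem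
  · refine iSup₂_le fun f hf => ?_
    rw [← sub_add_sub_cancel _ (∫ x, f x ∂(σ : Measure G.Point)), EReal.coe_add]
    exact add_le_add (hle μ σ f hf) (hle σ ν f hf)
  · exact ⟨hsep hb' hσ hω μ ν, fun h => h ▸ hself μ⟩
  · intro hb' hfin hω hw
    have hc : 0 < w₁ z + b * lam / 2 - α := by linarith [min_le_left (w₁ z) (w₂ z)]
    obtain ⟨B, hB⟩ := PhysicalGraph.exists_bound_criticSet ω z b lam α w₁ w₂
      (q := p.conjExponent) (by simp [ENNReal.conjExponent])
    exact PhysicalGraph.exists_metricSpace (fun f hf => hf.1)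
      (fun f hf => PhysicalGraph.neg_mem_criticSet hw hf) hB hc
      (PhysicalGraph.const_mem_criticSet ω _ ⟨by linarith, le_rfl⟩)
      fun μ ν h => hsep hb' inferInstance hω μ ν
        (le_antisymm (iSup₂_le fun f hf => by simp [h f hf]) (by simpa using hle μ ν _ h0mem))
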